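/- **Parameters.** Let $x_{\rm ref}>0$, $0<\alpha_{\rm on}<\log 2$, let $\beta>0$ satisfy $$2x_{\rm ref}\alpha_{\rm on}<\beta<\frac{e^{\alpha_{\rm on}}}{e^{\alpha_{\rm on}}-1}\,x_{\rm ref}\alpha_{\rm on},$$ and let $\alpha_{\rm off}>0$ satisfy $$\alpha_{\rm on}<\alpha_{\rm off}<\frac{\beta/\alpha_{\rm on}-x_{\rm ref}}{x_{\rm ref}}\,\alpha_{\rm on}.$$ Put $x_{\rm border}=\beta/\alpha_{\rm on}+(x_{\rm ref}-\beta/\alpha_{\rm on})e^{\alpha_{\rm on}}$ and define $f$ on $[0,x_{\rm ref}]$ by $$f(x)=\begin{cases}\dfrac{\beta}{\alpha_{\rm on}}+\Big(x-\dfrac{\beta}{\alpha_{\rm on}}\Big)e^{-\alpha_{\rm on}}, & 0\le x\le x_{\rm border},\\[2mm] x_{\rm ref}\,e^{-\alpha_{\rm off}}\Big(\dfrac{\beta/\alpha_{\rm on}-x}{\beta/\alpha_{\rm on}-x_{\rm ref}}\Big)^{\alpha_{\rm off}/\alpha_{\rm on}}, & x_{\rm border}<x\le x_{\rm ref}.\end{cases}$$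 Let $x^*\in[0,x_{\rm ref}]$ be the fixed point of $f$, $f(x^*)=x^*$. **Stochastic system.** Let $W$ be a standard one-dimensional Brownian motion on a probability space $(\Omega,\mathcal F,\mathbb P)$ and let $I$ be a continuous version of $I_t=\int_0^t e^{\alpha_{\rm on}u}\,dW_u$. For $\varepsilon\in(0,1)$ define the following recursively, with $\inf\emptyset=\infty$. Put $\sigma_0^\varepsilon=0$ and $v_0^\varepsilon=x^*$. For $n\ge1$ put $$X^{n,\varepsilon,{\rm on}}_t=1_{[\sigma^\varepsilon_{n-1},\infty)}(t)\Big\{\tfrac{\beta}{\alpha_{\rm on}}+\big(v_{n-1}^\varepsilon-\tfrac{\beta}{\alpha_{\rm on}}\big)e^{-\alpha_{\rm on}(t-\sigma^\varepsilon_{n-1})}+\varepsilon e^{-\alpha_{\rm on}t}\big(I_t-I_{t\wedge\sigma^\varepsilon_{n-1}}\big)\Big\},$$ $$\tau_n^\varepsilon=\inf\{t>\sigma_{n-1}^\varepsilon: X_t^{n,\varepsilon,{\rm on}}=x_{\rm ref}\},\qquad X^{n,\varepsilon,{\rm off}}_t=1_{[\tau_n^\varepsilon,\infty)}(t)\,x_{\rm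 ref}e^{-\alpha_{\rm off}(t-\tau_n^\varepsilon)},$$ $$\sigma_n^\varepsilon=\inf\{t>\tau_n^\varepsilon:t\in\mathbb Z\},\qquad v_n^\varepsilon=X^{n,\varepsilon,{\rm off}}_{\sigma_n^\varepsilon}.$$ The process $Z^\varepsilon=(X^\varepsilon,Y^\varepsilon)$ with values in $\mathbb R\times\{0,1\}$ is $$X^\varepsilon_t=\sum_{n\ge1}\big(X^{n,\varepsilon,{\rm on}}_t1_{[\sigma_{n-1}^\varepsilon,\tau_n^\varepsilon)}(t)+X^{n,\varepsilon,{\rm off}}_t1_{[\tau_n^\varepsilon,\sigma_n^\varepsilon)}(t)\big),\qquad Y^\varepsilon_t=\sum_{n\ge1}1_{[\sigma_{n-1}^\varepsilon,\tau_n^\varepsilon)}(t).$$ Thus $Z^\varepsilon_0=(x^*,1)$ almost surely. In the ON state ($Y^\varepsilon=1$) the process $X^\varepsilon$ solves $dX=(-\alpha_{\rm on}X+\beta)\,dt+\varepsilon\,dW$, in the OFF state it solves $dX=-\alpha_{\rm off}X\,dt$, the switch ON$\to$OFF occurs when $X^\varepsilon$ hits $x_{\rm ref}$, and the switch OFF$\to$ON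 occurs at the next integer time. **Deterministic system.** $z=(x,y)$ is the trajectory given by the same formulas with the noise term omitted ($\varepsilon=0$), with $z(0)=(x^*,1)$. **Skorokhod distance.** Let $r$ be the Euclidean distance on $\mathbb R\times\{0,1\}\subset\mathbb R^2$. For an integer $T\ge1$ let $$d_{[0,T]}(z_1,z_2)=\inf_{\lambda\in\Lambda_T}\Big\{\gamma_T(\lambda)\vee\sup_{0\le t\le T}r\big(z_1(t),z_2(\lambda(t))\big)\Big\},\qquad \gamma_T(\lambda)=\sup_{0\le s<t\le T}\Big|\log\frac{\lambda(t)-\lambda(s)}{t-s}\Big|,$$ where $\Lambda_T$ is the set of strictly increasing continuous maps $\lambda$ of $[0,T]$ onto itself with $\gamma_T(\lambda)<\infty$. **Theorem.** Fix $\mathfrak T\in\mathbb N$ and $0\le\nu<2/3$, and for each $\varepsilon\in(0,1)$ let $\mathsf T_\varepsilon\ge 1$ be an integer with $\mathsf T_\varepsilon\le\mathfrak T/\varepsilon^\nu$. Then $d_{[0,\mathsf T_\varepsilon]}(Z^\varepsilon,z)$ is a (almost everywhere measurable) random variable for every $\varepsilon\in(0,1)$; for every $p\in[1,\infty)$ it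 has a finite $p$-th moment for every $\varepsilon\in(0,1)$, and $$\lim_{\varepsilon\searrow0}\mathbb E\Big[\big(d_{[0,\mathsf T_\varepsilon]}(Z^\varepsilon,z)\big)^p\Big]=0 .$$ In particular, for every $\vartheta>0$, $\lim_{\varepsilon\searrow0}\mathbb P\big\{d_{[0,\mathsf T_\varepsilon]}(Z^\varepsilon,z)\ge\vartheta\big\}=0$. -/

import Mathlib

open MeasureTheory ProbabilityTheory Filter Topology Set
open scoped NNReal ENNReal

noncomputable section

namespace BuckConverter

/-- The parameters of the first-order buck converter: reference level, resistances in the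
ON and OFF configurations, and input voltage (all rescaled). -/
structure Params where
  xref : ℝ
  αon : ℝ
  αoff : ℝ
  β : ℝ

/-- The standing assumption on the parameters. -/
structure Params.Admissible (q : Params) : Prop where
  xref_pos : 0 < q.xref
  αon_pos : 0 < q.αon
  αon_lt : q.αon < Real.log 2
  β_pos : 0 < q.β
  lt_β : 2 * q.xref * q.αon < q.β
  β_lt : q.β < Real.exp q.αon / (Real.exp q.αon - 1) * q.xref * q.αon
  αoff_pos : 0 < q.αoff
  lt_αoff : q.αon < q.αoff
  αoff_lt : q.αoff < (q.β / q.αon - q.xref) / q.xref * q.αon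

/-- The initial value from which the ON dynamics reach `xref` exactly at time `1`. -/
def Params.xborder (q : Params) : ℝ :=
  q.β / q.αon + (q.xref - q.β / q.αon) * Real.exp q.αon

/-- The stroboscopic map, which sends `x ∈ [0, xref]` to the value at time `1` of the continuous
component of the deterministic system started at `(x, 1)`. -/
def Params.strobe (q : Params) (x : ℝ) : ℝ :=
  if x ≤ q.xborder then
    q.β / q.αon + (x - q.β / q.αon) * Real.exp (-q.αon)
  else
    q.xref * Real.exp (-q.αoff) *
      ((q.β / q.αon - x) / (q.β / q.αon - q.xref)) ^ (q.αoff / q.αon)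

/-! ### One path of the switching system

Everything here is a deterministic function of a path `I : ℝ≥0 → ℝ` (to be a sample path of
`∫₀ᵗ e^{αon u} dW_u`) and of the noise size `ε`; `ε = 0`, `I = 0` is the unperturbed system.
Switching times lie in `[0, ∞]`, and the infimum of the empty set is `∞`. -/

/-- The path in the ON configuration, started at time `σ` from the value `v` (and `0` before `σ`):
the explicit solution of `dX = (-αon X + β) dt + ε dW`. -/
def onPath (q : Params) (ε : ℝ) (I : ℝ≥0 → ℝ) (σ : ℝ≥0∞) (v : ℝ) (t : ℝ≥0) : ℝ :=
  if σ ≤ t then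
    q.β / q.αon + (v - q.β / q.αon) * Real.exp (-q.αon * (t - σ.toReal))
      + ε * Real.exp (-q.αon * t) * (I t - I (min (t : ℝ≥0∞) σ).toNNReal)
  else 0

/-- The first time after `σ` at which the ON path is at the level `xref`. -/
def passageTime (q : Params) (ε : ℝ) (I : ℝ≥0 → ℝ) (σ : ℝ≥0∞) (v : ℝ) : ℝ≥0∞ :=
  sInf {s | ∃ t : ℝ≥0, s = t ∧ σ < t ∧ onPath q ε I σ v t = q.xref}

/-- The path in the OFF configuration, started at time `τ` from `xref` (and `0` before `τ`):
the solution of `dx/dt = -αoff x`. -/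
def offPath (q : Params) (τ : ℝ≥0∞) (t : ℝ≥0) : ℝ :=
  if τ ≤ t then q.xref * Real.exp (-q.αoff * (t - τ.toReal)) else 0

/-- The first integer time strictly after `τ`. -/
def nextPulse (τ : ℝ≥0∞) : ℝ≥0∞ :=
  sInf {s | τ < s ∧ ∃ k : ℕ, s = k}

/-- The start of the `n`-th ON/OFF cycle (`n = 0, 1, …`), for a start at `(x₀, 1)`: the time of
the OFF → ON transition (time `0` for the first cycle) and the value of the continuous component
at that time, which is carried over from the OFF path of the preceding cycle. -/
def cycleStart (q : Params) (ε : ℝ) (I : ℝ≥0 → ℝ) (x₀ : ℝ) : ℕ → ℝ≥0∞ × ℝ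
  | 0 => (0, x₀)
  | n + 1 =>
    let c := cycleStart q ε I x₀ n
    let τ := passageTime q ε I c.1 c.2
    (nextPulse τ, offPath q τ (nextPulse τ).toNNReal)

/-- The time at which the `n`-th cycle starts (OFF → ON). -/
def σtime (q : Params) (ε : ℝ) (I : ℝ≥0 → ℝ) (x₀ : ℝ) (n : ℕ) : ℝ≥0∞ :=
  (cycleStart q ε I x₀ n).1

/-- The time of the ON → OFF transition in the `n`-th cycle. -/
def τtime (q : Params) (ε : ℝ) (I : ℝ≥0 → ℝ) (x₀ : ℝ) (n : ℕ) : ℝ≥0∞ :=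
  passageTime q ε I (σtime q ε I x₀ n) (cycleStart q ε I x₀ n).2

/-- The continuous component: the ON and OFF pieces of all cycles, put together. -/
def xPath (q : Params) (ε : ℝ) (I : ℝ≥0 → ℝ) (x₀ : ℝ) (t : ℝ≥0) : ℝ :=
  ∑' n : ℕ,
    ((Ico (σtime q ε I x₀ n) (τtime q ε I x₀ n)).indicator 1 (t : ℝ≥0∞)
        * onPath q ε I (σtime q ε I x₀ n) (cycleStart q ε I x₀ n).2 t
      + (Ico (τtime q ε I x₀ n) (σtime q ε I x₀ (n + 1))).indicator 1 (t : ℝ≥0∞)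
        * offPath q (τtime q ε I x₀ n) t)

/-- The discrete component: `1` while the system is ON and `0` while it is OFF. -/
def yPath (q : Params) (ε : ℝ) (I : ℝ≥0 → ℝ) (x₀ : ℝ) (t : ℝ≥0) : ℝ :=
  ∑' n : ℕ, (Ico (σtime q ε I x₀ n) (τtime q ε I x₀ n)).indicator 1 (t : ℝ≥0∞)

theorem σtime_le_τtime (q : Params) (ε : ℝ) (I : ℝ≥0 → ℝ) (x₀ : ℝ) (n : ℕ) :
    σtime q ε I x₀ n ≤ τtime q ε I x₀ n := by
  refine le_sInf ?_
  rintro _ ⟨t, rfl, ht, -⟩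
  exact ht.le

theorem τtime_le_σtime_succ (q : Params) (ε : ℝ) (I : ℝ≥0 → ℝ) (x₀ : ℝ) (n : ℕ) :
    τtime q ε I x₀ n ≤ σtime q ε I x₀ (n + 1) :=
  le_sInf fun _ hs => hs.1.le

/-- The discrete component takes values in `{0, 1}`. -/
theorem yPath_mem (q : Params) (ε : ℝ) (I : ℝ≥0 → ℝ) (x₀ : ℝ) (t : ℝ≥0) :
    yPath q ε I x₀ t = 0 ∨ yPath q ε I x₀ t = 1 := by
  have hmono : Monotone (σtime q ε I x₀) := monotone_nat_of_le_succ fun n =>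
    (σtime_le_τtime q ε I x₀ n).trans (τtime_le_σtime_succ q ε I x₀ n)
  by_cases h : ∃ n, (t : ℝ≥0∞) ∈ Ico (σtime q ε I x₀ n) (τtime q ε I x₀ n)
  · obtain ⟨n, hn⟩ := h
    right
    rw [yPath, tsum_eq_single n, indicator_of_mem hn, Pi.one_apply]
    intro m hm
    refine indicator_of_notMem (fun hm' => ?_) _
    rcases lt_or_gt_of_ne hm with hlt | hlt
    · exact absurd (hn.1.trans_lt hm'.2)
        (not_lt.2 ((τtime_le_σtime_succ q ε I x₀ m).trans (hmono hlt)))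
    · exact absurd (hm'.1.trans_lt hn.2)
        (not_lt.2 ((τtime_le_σtime_succ q ε I x₀ n).trans (hmono hlt)))
  · left
    push Not at h
    rw [yPath]
    simp [indicator_of_notMem (h _)]

/-- The state space `ℝ × {0, 1}`, with the Euclidean metric inherited from `ℝ²`. -/
abbrev State : Type := {z : EuclideanSpace ℝ (Fin 2) // z 1 = 0 ∨ z 1 = 1}

/-- The path of the full state `(x, y)` started at `(x₀, 1)`. -/
def statePath (q : Params) (ε : ℝ) (I : ℝ≥0 → ℝ) (x₀ : ℝ) (t : ℝ≥0) : State :=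
  ⟨!₂[xPath q ε I x₀ t, yPath q ε I x₀ t], by simpa using yPath_mem q ε I x₀ t⟩

/-- The trajectory `z` of the deterministic (unperturbed) switching system. -/
def detState (q : Params) (x₀ : ℝ) : ℝ≥0 → State :=
  statePath q 0 0 x₀

/-- The stochastic switching process `Z^ε`, where `I` is the process `∫₀ᵗ e^{αon u} dW_u`. -/
def noisyState {Ω : Type*} (q : Params) (ε : ℝ) (I : ℝ≥0 → Ω → ℝ) (x₀ : ℝ) (ω : Ω) : ℝ≥0 → State :=
  statePath q ε (fun t => I t ω) x₀

/-! ### The Wiener integral and the Skorokhod metric -/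

/-- `I` is a continuous version of the Wiener integral `I_t = ∫₀ᵗ f(u) dW_u` of a continuous
deterministic integrand `f`: it has almost surely continuous paths, and each `I_t` is the
limit in `L²` of the integrals of the step functions that interpolate `f` at the left end points
of the partition of `[0, t]` into `n` equal parts. -/
structure IsWienerIntegral {Ω : Type*} [MeasurableSpace Ω] (P : Measure Ω)
    (f : ℝ≥0 → ℝ) (W I : ℝ≥0 → Ω → ℝ) : Prop where
  cont : ∀ᵐ ω ∂P, Continuous fun t => I t ω
  memLp : ∀ t, MemLp (I t) 2 P
  tendsto : ∀ t : ℝ≥0, Tendsto (fun n : ℕ => eLpNorm (fun ω =>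
      (∑ k ∈ Finset.range n, f (t * k / n) * (W (t * (k + 1) / n) ω - W (t * k / n) ω))
        - I t ω) 2 P) atTop (𝓝 0)

/-- The functional `γ_T(lam) = sup_{0 ≤ s < t ≤ T} |log ((lam t - lam s) / (t - s))|` in `[0, ∞]`. -/
def logSlope (T : ℝ≥0) (lam : ℝ≥0 → ℝ≥0) : ℝ≥0∞ :=
  ⨆ (s : ℝ≥0) (t : ℝ≥0) (_ : s < t ∧ t ≤ T),
    ENNReal.ofReal |Real.log (((lam t : ℝ) - lam s) / ((t : ℝ) - s))|

/-- The time deformations of `[0, T]`: strictly increasing continuous maps of `[0, T]` onto itself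
with finite `γ_T` (values outside `[0, T]` play no role). -/
def timeChanges (T : ℝ≥0) : Set (ℝ≥0 → ℝ≥0) :=
  {lam | StrictMonoOn lam (Icc 0 T) ∧ ContinuousOn lam (Icc 0 T) ∧
    lam '' Icc 0 T = Icc 0 T ∧ logSlope T lam < ∞}

/-- The Skorokhod distance on `[0, T]` of two paths, as an element of `[0, ∞]`. -/
def skorokhodDist {E : Type*} [PseudoEMetricSpace E] (T : ℝ≥0) (z₁ z₂ : ℝ≥0 → E) : ℝ≥0∞ :=
  ⨅ lam ∈ timeChanges T,
    max (logSlope T lam) (⨆ t ∈ Icc (0 : ℝ≥0) T, edist (z₁ t) (z₂ (lam t)))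

end BuckConverter

end

namespace BuckConverter

/-! The heart is a pathwise estimate, `exists_skorokhodDist_le`. If on each clock period `[k, k +
1]` the scaled noise `ε * (I t - I k)` is at most `S * exp (αon * k)`, then the distance is at most
`C * S`, with `C` independent of the path, of `ε` and of the horizon. For small `S` this holds
because the fixed point is stable. It lies strictly inside the branch of the stroboscopic map where
the level is reached before the period ends. In the variable `gap * exp (αon * θ)`, with `θ` the ON
time, one period adds an error of at most `exp αon * S`, and the return map then contracts by `rate
< 1`. So deviations at integer times stay below `ampl * S` forever, and there is exactly one switch
per period (`cycle_near_fixed`, `passage_time_near`). A time change fixing the integers and matching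
the two switching times in each period has log-slope `O(S)`, because its nodes are uniformly
separated (`exists_aligning_timeChange`). For `S` bounded away from zero a crude bound, affine in
`S`, suffices (`skorokhodDist_le_crude`).

The random `S` is controlled by high moments. Summation by parts bounds increments of `I` by those
of `W`, so no stochastic calculus is needed (`IsWienerIntegral.ae_abs_sub_le`). Dyadic chaining
bounds the oscillation of `W` over a period by a `2m`-th root of an energy whose mean is finite and
the same bound for all periods (`lintegral_dyadicEnergy_le`). Summing energies over the periods
gives a `2m`-th moment of at most `K * T * ε ^ (2 * m)`; with `T ≤ T₀ / ε ^ ν` and `m ≥ 3` this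
tends to zero. Lyapunov's inequality passes to general `p`, Markov's to probabilities.

Measurability comes from approximating the path, in Skorokhod distance, by step functions that read
it at finitely many times (`measurable_skorokhodDist`). -/

/-! ### Time changes and the Skorokhod distance -/

theorem abs_log_le_two_mul {x K : ℝ} (hK : K ≤ 1 / 2) (hx : |x - 1| ≤ K) :
    |Real.log x| ≤ 2 * K := by
  obtain ⟨h1, h2⟩ := abs_le.1 hx
  have hx0 : 0 < x := by linarith
  have hK0 : 0 ≤ K := (abs_nonneg _).trans hx
  refine abs_le.2 ⟨?_, ?_⟩
  · have h3 := Real.one_sub_inv_le_log_of_pos hx0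
    have h4 : x⁻¹ ≤ 1 + 2 * K := by
      rw [inv_le_iff_one_le_mul₀ hx0]
      nlinarith
    linarith
  · have := Real.log_le_sub_one_of_pos hx0
    linarith

/-- The time change is the identity plus a Lipschitz extension of the displacement `h` prescribed at
the nodes `A`. Slopes stay within `K` of `1`, which gives both monotonicity and the bound on the
logarithm. -/
theorem exists_timeChange {T : ℝ≥0} {A : Set ℝ≥0} {h : ℝ≥0 → ℝ} {K : ℝ≥0} (hK : K ≤ 1 / 2)
    (hh : LipschitzOnWith K h A) (h0A : 0 ∈ A) (hTA : T ∈ A) (h0 : h 0 = 0) (hT : h T = 0) :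
    ∃ lam ∈ timeChanges T, logSlope T lam ≤ 2 * K ∧ StrictMono lam ∧
      (∀ a ∈ A, (lam a : ℝ) = a + h a) ∧
      ∀ s t, |((lam t : ℝ) - t) - (lam s - s)| ≤ K * |(t : ℝ) - s| := by
  obtain ⟨g, hg, hgA⟩ := hh.extend_real
  have hKr : (K : ℝ) ≤ 1 / 2 := by exact_mod_cast hK
  have hlip : ∀ s t : ℝ≥0, |g t - g s| ≤ K * |(t : ℝ) - s| := fun s t => by
    simpa [Real.dist_eq, NNReal.dist_eq] using hg.dist_le_mul t s
  have hg0 : g 0 = 0 := by rw [← hgA h0A, h0]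
  have hnn : ∀ t : ℝ≥0, 0 ≤ (t : ℝ) + g t := fun t => by
    have := (abs_le.1 (hlip 0 t)).1
    rw [hg0, NNReal.coe_zero, sub_zero, sub_zero, abs_of_nonneg t.coe_nonneg] at this
    nlinarith [t.coe_nonneg]
  set lam : ℝ≥0 → ℝ≥0 := fun t => ⟨t + g t, hnn t⟩ with hlam
  have hl : ∀ t, (lam t : ℝ) = t + g t := fun t => rfl
  have hmono : StrictMono lam := fun s t hst => by
    rw [← NNReal.coe_lt_coe, hl, hl]
    have hst' : (s : ℝ) < t := hst
    have := (abs_le.1 (hlip s t)).1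
    rw [abs_of_pos (sub_pos.2 hst')] at this
    nlinarith
  have hcont : Continuous lam :=
    (NNReal.continuous_coe.add hg.continuous).subtype_mk _
  have hl0 : lam 0 = 0 := by ext; rw [hl, hg0]; simp
  have hlT : lam T = T := by ext; rw [hl, ← hgA hTA, hT]; simp
  have hslope : logSlope T lam ≤ 2 * K := by
    refine iSup_le fun s => iSup_le fun t => iSup_le fun hst => ?_
    have hst' : (0 : ℝ) < t - s := sub_pos.2 hst.1
    have : ENNReal.ofReal (2 * K) = 2 * (K : ℝ≥0∞) := by
      rw [ENNReal.ofReal_mul zero_le_two, ENNReal.ofReal_coe_nnreal]; simp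
    rw [← this]
    refine ENNReal.ofReal_le_ofReal (abs_log_le_two_mul hKr ?_)
    have h1 : ((lam t : ℝ) - lam s) / (t - s) - 1 = (g t - g s) / (t - s) := by
      rw [hl, hl]; field_simp; ring
    rw [h1, abs_div, abs_of_pos hst', div_le_iff₀ hst']
    simpa [abs_of_pos hst'] using hlip s t
  refine ⟨lam, ⟨hmono.strictMonoOn _, hcont.continuousOn, ?_, hslope.trans_lt ?_⟩, hslope, hmono,
    fun a ha => by rw [hl, hgA ha], fun s t => ?_⟩
  · refine Subset.antisymm ?_ ?_
    · rintro _ ⟨t, ht, rfl⟩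
      exact ⟨zero_le, (hmono.monotone ht.2).trans hlT.le⟩
    · have := intermediate_value_Icc (zero_le : 0 ≤ T) (hcont.continuousOn (s := Icc 0 T))
      rwa [hl0, hlT] at this
  · exact ENNReal.mul_lt_top (by simp) (by simp)
  · rw [hl, hl]
    simpa using hlip s t

theorem id_mem_timeChanges (T : ℝ≥0) : id ∈ timeChanges T ∧ logSlope T id = 0 := by
  have : logSlope T id = 0 := by
    refine le_antisymm (iSup_le fun s => iSup_le fun t => iSup_le fun hst => ?_) zero_le
    have hst' : (0 : ℝ) < t - s := sub_pos.2 hst.1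
    simp [div_self hst'.ne']
  exact ⟨⟨strictMono_id.strictMonoOn _, continuousOn_id, image_id _, by simp [this]⟩, this⟩

theorem skorokhodDist_le {E : Type*} [PseudoEMetricSpace E] {T : ℝ≥0} {z₁ z₂ : ℝ≥0 → E}
    {lam : ℝ≥0 → ℝ≥0} {c : ℝ≥0∞} (hlam : lam ∈ timeChanges T) (h1 : logSlope T lam ≤ c)
    (h2 : ∀ t ≤ T, edist (z₁ t) (z₂ (lam t)) ≤ c) : skorokhodDist T z₁ z₂ ≤ c :=
  (iInf₂_le lam hlam).trans (max_le h1 (iSup₂_le fun t ht => h2 t ht.2))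

theorem exists_of_skorokhodDist_lt {E : Type*} [PseudoEMetricSpace E] {T : ℝ≥0}
    {z₁ z₂ : ℝ≥0 → E} {c : ℝ≥0∞} (h : skorokhodDist T z₁ z₂ < c) :
    ∃ lam ∈ timeChanges T, logSlope T lam ≤ c ∧ ∀ t ≤ T, edist (z₁ t) (z₂ (lam t)) ≤ c := by
  simp only [skorokhodDist, iInf_lt_iff] at h
  obtain ⟨lam, hlam, h⟩ := h
  exact ⟨lam, hlam, (le_max_left _ _).trans h.le,
    fun t ht => (le_iSup₂ (f := fun t _ => edist (z₁ t) (z₂ (lam t))) t ⟨zero_le, ht⟩).trans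
      ((le_max_right _ _).trans h.le)⟩

theorem ofReal_abs_log_le_logSlope {T s t : ℝ≥0} (lam : ℝ≥0 → ℝ≥0) (hst : s < t) (ht : t ≤ T) :
    ENNReal.ofReal |Real.log (((lam t : ℝ) - lam s) / ((t : ℝ) - s))| ≤ logSlope T lam :=
  le_iSup_of_le s (le_iSup_of_le t (le_iSup_of_le ⟨hst, ht⟩ le_rfl))

theorem timeChanges_apply_le {T : ℝ≥0} {lam : ℝ≥0 → ℝ≥0} (hlam : lam ∈ timeChanges T) {t : ℝ≥0}
    (ht : t ≤ T) : lam t ≤ T := by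
  have : lam t ∈ lam '' Icc 0 T := ⟨t, ⟨zero_le, ht⟩, rfl⟩
  rw [hlam.2.2.1] at this
  exact this.2

theorem logSlope_comp_le {T : ℝ≥0} {lam mu : ℝ≥0 → ℝ≥0} (hlam : lam ∈ timeChanges T)
    (hmu : mu ∈ timeChanges T) : logSlope T (mu ∘ lam) ≤ logSlope T lam + logSlope T mu := by
  refine iSup_le fun s => iSup_le fun t => iSup_le fun ⟨hst, ht⟩ => ?_
  have hsT := hst.le.trans ht
  have h1 : lam s < lam t := hlam.1 ⟨zero_le, hsT⟩ ⟨zero_le, ht⟩ hst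
  have h2 : mu (lam s) < mu (lam t) := hmu.1 ⟨zero_le, timeChanges_apply_le hlam hsT⟩
    ⟨zero_le, timeChanges_apply_le hlam ht⟩ h1
  have h0' : (0 : ℝ) < t - s := sub_pos.2 hst
  have h1' : (0 : ℝ) < lam t - lam s := sub_pos.2 h1
  have h2' : (0 : ℝ) < mu (lam t) - mu (lam s) := sub_pos.2 h2
  have : ((mu (lam t) : ℝ) - mu (lam s)) / ((t : ℝ) - s) =
      (((lam t : ℝ) - lam s) / ((t : ℝ) - s)) *
        (((mu (lam t) : ℝ) - mu (lam s)) / ((lam t : ℝ) - lam s)) := by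
    field_simp
  simp only [Function.comp_apply]
  rw [this, Real.log_mul (div_pos h1' h0').ne' (div_pos h2' h1').ne']
  refine (ENNReal.ofReal_le_ofReal (abs_add_le _ _)).trans ?_
  rw [ENNReal.ofReal_add (abs_nonneg _) (abs_nonneg _)]
  exact add_le_add (ofReal_abs_log_le_logSlope lam hst ht)
    (ofReal_abs_log_le_logSlope mu h1 (timeChanges_apply_le hlam ht))

theorem comp_mem_timeChanges {T : ℝ≥0} {lam mu : ℝ≥0 → ℝ≥0} (hlam : lam ∈ timeChanges T)
    (hmu : mu ∈ timeChanges T) : mu ∘ lam ∈ timeChanges T := by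
  have hmaps : MapsTo lam (Icc 0 T) (Icc 0 T) := fun t ht =>
    ⟨zero_le, timeChanges_apply_le hlam ht.2⟩
  exact ⟨hmu.1.comp hlam.1 hmaps, hmu.2.1.comp hlam.2.1 hmaps,
    by rw [image_comp, hlam.2.2.1, hmu.2.2.1],
    (logSlope_comp_le hlam hmu).trans_lt (ENNReal.add_lt_top.2 ⟨hlam.2.2.2, hmu.2.2.2⟩)⟩

theorem skorokhodDist_triangle {E : Type*} [PseudoEMetricSpace E] (T : ℝ≥0)
    (z₁ z₂ z₃ : ℝ≥0 → E) :
    skorokhodDist T z₁ z₃ ≤ skorokhodDist T z₁ z₂ + skorokhodDist T z₂ z₃ := by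
  rcases eq_or_ne (skorokhodDist T z₁ z₂) ∞ with h | h
  · simp [h]
  rcases eq_or_ne (skorokhodDist T z₂ z₃) ∞ with h' | h'
  · simp [h']
  refine ENNReal.le_of_forall_pos_le_add fun δ hδ _ => ?_
  have hδ2 : (0 : ℝ≥0∞) < (δ / 2 : ℝ≥0) := by simpa [pos_iff_ne_zero] using hδ
  obtain ⟨lam, hlam, hl1, hl2⟩ := exists_of_skorokhodDist_lt (ENNReal.lt_add_right h hδ2.ne')
  obtain ⟨mu, hmu, hm1, hm2⟩ := exists_of_skorokhodDist_lt (ENNReal.lt_add_right h' hδ2.ne')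
  have hsum : skorokhodDist T z₁ z₂ + (δ / 2 : ℝ≥0) + (skorokhodDist T z₂ z₃ + (δ / 2 : ℝ≥0))
      = skorokhodDist T z₁ z₂ + skorokhodDist T z₂ z₃ + δ := by
    rw [add_add_add_comm, ← ENNReal.coe_add, add_halves]
  rw [← hsum]
  exact skorokhodDist_le (comp_mem_timeChanges hlam hmu)
    ((logSlope_comp_le hlam hmu).trans (add_le_add hl1 hm1)) fun t ht =>
      (edist_triangle _ (z₂ (lam t)) _).trans
        (add_le_add (hl2 t ht) (hm2 _ (timeChanges_apply_le hlam ht)))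

theorem exists_inverse_timeChange {T : ℝ≥0} {lam : ℝ≥0 → ℝ≥0} (hlam : lam ∈ timeChanges T) :
    ∃ mu ∈ timeChanges T, logSlope T mu ≤ logSlope T lam ∧ ∀ t ≤ T, lam (mu t) = t := by
  have hex : ∀ t : Icc 0 T, ∃ s ∈ Icc 0 T, lam s = t := fun t =>
    hlam.2.2.1.symm.subset t.2
  choose! f hf hlf using hex
  -- Clamping to `[0, T]` makes the inverse total; its values beyond `T` do not matter.
  set mu : ℝ≥0 → ℝ≥0 := fun t => f (projIcc 0 T zero_le t)
  have hmuT : ∀ t, mu t ∈ Icc 0 T := fun t => hf _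
  have hinv : ∀ t ≤ T, lam (mu t) = t := fun t ht => by
    have := hlf (projIcc 0 T zero_le t)
    have hp := projIcc_of_mem (zero_le : 0 ≤ T) ⟨zero_le, ht⟩
    simpa only [mu, hp] using this
  have hmono : StrictMonoOn mu (Icc 0 T) := fun s hs t ht hst => by
    rw [← hlam.1.lt_iff_lt (hmuT s) (hmuT t), hinv s hs.2, hinv t ht.2]
    exact hst
  have himage : mu '' Icc 0 T = Icc 0 T := by
    refine Subset.antisymm ?_ fun t ht => ⟨lam t, ⟨zero_le, timeChanges_apply_le hlam ht.2⟩, ?_⟩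
    · rintro _ ⟨t, -, rfl⟩
      exact hmuT t
    · exact hlam.1.injOn (hmuT _) ht (hinv _ (timeChanges_apply_le hlam ht.2))
  have hslope : logSlope T mu ≤ logSlope T lam := by
    refine iSup_le fun s => iSup_le fun t => iSup_le fun ⟨hst, ht⟩ => ?_
    have hsT := hst.le.trans ht
    have h1 := ofReal_abs_log_le_logSlope lam (hmono ⟨zero_le, hsT⟩ ⟨zero_le, ht⟩ hst) (hmuT t).2
    rw [hinv t ht, hinv s hsT, ← inv_div, Real.log_inv, abs_neg] at h1
    exact h1
  refine ⟨mu, ⟨hmono, ?_, himage, hslope.trans_lt hlam.2.2.2⟩, hslope, hinv⟩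
  -- A strictly monotone map of `[0, T]` onto itself is an order isomorphism, hence continuous.
  rw [continuousOn_iff_continuous_domRestrict]
  have : (Icc 0 T).domRestrict mu =
      fun t => (((hmono.orderIso mu (Icc 0 T)).trans (OrderIso.setCongr _ _ himage)) t : ℝ≥0) := by
    ext t; rfl
  rw [this]
  exact continuous_subtype_val.comp (OrderIso.continuous _)

theorem skorokhodDist_comm {E : Type*} [PseudoEMetricSpace E] (T : ℝ≥0) (z₁ z₂ : ℝ≥0 → E) :
    skorokhodDist T z₁ z₂ = skorokhodDist T z₂ z₁ := by
  suffices h : ∀ z₁ z₂ : ℝ≥0 → E, skorokhodDist T z₂ z₁ ≤ skorokhodDist T z₁ z₂ from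
    le_antisymm (h _ _) (h _ _)
  intro z₁ z₂
  refine le_of_forall_gt fun c hc => ?_
  obtain ⟨c', hc', hcc⟩ := exists_between hc
  obtain ⟨lam, hlam, hl1, hl2⟩ := exists_of_skorokhodDist_lt hc'
  obtain ⟨mu, hmu, hm1, hm2⟩ := exists_inverse_timeChange hlam
  refine (skorokhodDist_le hmu (hm1.trans hl1) fun t ht => ?_).trans_lt hcc
  have := hl2 (mu t) (timeChanges_apply_le hmu ht)
  rwa [hm2 t ht, edist_comm] at this

theorem skorokhodDist_congr_left {E : Type*} [PseudoEMetricSpace E] {T : ℝ≥0}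
    {z₁ z₁' : ℝ≥0 → E} (z₂ : ℝ≥0 → E) {c : ℝ≥0∞} (h : ∀ t ≤ T, edist (z₁ t) (z₁' t) ≤ c) :
    skorokhodDist T z₁ z₂ ≤ skorokhodDist T z₁' z₂ + c := by
  refine (skorokhodDist_triangle T z₁ z₁' z₂).trans ?_
  rw [add_comm]
  refine add_le_add le_rfl (skorokhodDist_le (id_mem_timeChanges T).1 ?_ h)
  simp [(id_mem_timeChanges T).2]

/-! ### Measurability of the Skorokhod distance through step approximations -/

/-- On `[0, T]` the path `z` oscillates arbitrarily little between the consecutive nodes of a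
suitable finite set of times. -/
def HasFineNodes {E : Type*} [PseudoEMetricSpace E] (T : ℝ≥0) (z : ℝ≥0 → E) : Prop :=
  ∀ δ : ℝ≥0, 0 < δ → ∃ A : Finset ℝ≥0, 0 ∈ A ∧ T ∈ A ∧
    ∀ s ≤ T, ∀ t ≤ T, (∀ a ∈ A, a ≤ s ↔ a ≤ t) → edist (z s) (z t) ≤ δ

/-- Push every node up to the next point of the grid of mesh `1 / (m + 1)`. Once the mesh is small
compared with the gaps between nodes, this displacement has a small Lipschitz constant, and the
deformed time, rounded down to the grid, lies on the same side of every node as the original time.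
The horizon is an integer, so it is itself a grid point and stays fixed. -/
theorem HasFineNodes.eventually_skorokhodDist_le {E : Type*} [PseudoEMetricSpace E] {T : ℕ}
    {z : ℝ≥0 → E} (hz : HasFineNodes T z) {δ : ℝ≥0} (hδ : 0 < δ) :
    ∀ᶠ m : ℕ in atTop, skorokhodDist T z (fun t => z (⌊((m : ℝ≥0) + 1) * t⌋₊ / (m + 1))) ≤ δ := by
  obtain ⟨A, h0A, hTA, hA⟩ := hz δ hδ
  set K : ℝ≥0 := min (δ / 2) (1 / 2)
  have hK0 : 0 < K := by positivity
  have hev : ∀ᶠ m : ℕ in atTop, ∀ a ∈ A, ∀ b ∈ A, a ≠ b →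
      1 / ((m : ℝ) + 1) ≤ K * |(a : ℝ) - b| := by
    refine (eventually_all_finset _).2 fun a _ => (eventually_all_finset _).2 fun b _ => ?_
    rcases eq_or_ne a b with h | h
    · simp [h]
    have hab : 0 < (K : ℝ) * |(a : ℝ) - b| :=
      mul_pos (by exact_mod_cast hK0) (abs_pos.2 (sub_ne_zero.2 (by exact_mod_cast h)))
    filter_upwards [tendsto_one_div_add_atTop_nhds_zero_nat.eventually (gt_mem_nhds hab)] with m hm _
    exact hm.le
  filter_upwards [hev] with m hm
  set M : ℝ≥0 := m + 1 with hM
  have hM0 : 0 < M := by positivity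
  clear_value M
  have hMr : (0 : ℝ) < M := by exact_mod_cast hM0
  set h : ℝ≥0 → ℝ := fun a => (⌈M * a⌉₊ : ℝ) / M - a
  have hh0 : ∀ a, 0 ≤ h a := fun a => by
    have : ((M * a : ℝ≥0) : ℝ) ≤ (⌈M * a⌉₊ : ℝ) := by exact_mod_cast Nat.le_ceil (M * a)
    rw [sub_nonneg, le_div_iff₀ hMr, mul_comm]
    exact_mod_cast this
  have hh1 : ∀ a, h a ≤ 1 / M := fun a => by
    have : (⌈M * a⌉₊ : ℝ) < (M * a : ℝ≥0) + 1 := by exact_mod_cast Nat.ceil_lt_add_one (zero_le : 0 ≤ M * a)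
    rw [sub_le_iff_le_add, div_le_iff₀ hMr, add_mul, one_div, inv_mul_cancel₀ hMr.ne']
    push_cast at this
    linarith
  have hlip : LipschitzOnWith K h A := by
    refine LipschitzOnWith.of_dist_le_mul fun a ha b hb => ?_
    rcases eq_or_ne a b with hab | hab
    · simp [hab]
    rw [Real.dist_eq, NNReal.dist_eq]
    refine le_trans (abs_le.2 ⟨?_, ?_⟩) ((hm a ha b hb hab))
    · have := hh0 a; have := hh1 b; simp only [hM] at *; push_cast at *; linarith
    · have := hh0 b; have := hh1 a; simp only [hM] at *; push_cast at *; linarith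
  have hhT : h T = 0 := by
    have : M * (T : ℝ≥0) = (((m + 1) * T : ℕ) : ℝ≥0) := by push_cast; rw [hM]
    simp only [h, this, Nat.ceil_natCast]
    rw [← NNReal.coe_natCast, ← this]
    push_cast
    field_simp
    simp
  obtain ⟨lam, hlam, hl1, hl2, hl3, -⟩ := exists_timeChange (T := T) (min_le_right _ _) hlip h0A hTA
    (by simp [h]) hhT
  refine skorokhodDist_le hlam (hl1.trans ?_) fun t ht => ?_
  · have : 2 * K ≤ δ := by
      have := min_le_left (δ / 2) (1 / 2)
      calc 2 * K ≤ 2 * (δ / 2) := by gcongr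
        _ = δ := by rw [mul_div_cancel₀]; simp
    exact_mod_cast this
  · refine hA _ ht _ ?_ fun a ha => ?_
    · have h1 : lam t ≤ T := timeChanges_apply_le hlam ht
      refine le_trans ?_ h1
      rw [div_le_iff₀ hM0, mul_comm]
      exact Nat.floor_le zero_le
    -- Rounding nodes up and times down are adjoint: `⌈M * a⌉₊ ≤ M * lam t` and `M * a ≤ ⌊M * lam
    -- t⌋₊` are the same condition on integers.
    · have h1 : a ≤ t ↔ (⌈M * a⌉₊ : ℝ≥0) / M ≤ lam t := by
        rw [← hl2.le_iff_le]
        have : lam a = (⌈M * a⌉₊ : ℝ≥0) / M := by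
          rw [← NNReal.coe_inj, hl3 a ha]
          simp [h]
        rw [this]
      rw [h1, div_le_iff₀ hM0, le_div_iff₀ hM0, mul_comm (lam t), mul_comm a, ← Nat.le_floor_iff zero_le,
        Nat.ceil_le]

theorem HasFineNodes.tendsto_skorokhodDist {E : Type*} [PseudoEMetricSpace E] {T : ℕ}
    {z : ℝ≥0 → E} (hz : HasFineNodes T z) :
    Tendsto (fun m : ℕ => skorokhodDist T z (fun t => z (⌊((m : ℝ≥0) + 1) * t⌋₊ / (m + 1))))
      atTop (𝓝 0) := by
  refine ENNReal.tendsto_nhds_zero.2 fun ε hε => ?_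
  obtain ⟨δ, hδ0, hδ⟩ := ENNReal.lt_iff_exists_nnreal_btwn.1 hε
  filter_upwards [hz.eventually_skorokhodDist_le (by exact_mod_cast hδ0)] with m hm
  exact hm.trans hδ.le

theorem continuous_skorokhodDist_step {E : Type*} [PseudoEMetricSpace E] (T : ℝ≥0) (N : ℕ)
    (k : ℝ≥0 → Fin N) (z : ℝ≥0 → E) :
    Continuous fun v : Fin N → E => skorokhodDist T (fun t => v (k t)) z := by
  refine continuous_of_le_add_edist 1 (by simp) fun v v' => ?_
  rw [one_mul]
  exact skorokhodDist_congr_left z fun t _ => edist_le_pi_edist v v' (k t)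

/-- A step approximation involves finitely many values of the path, and the distance depends on them
in a 1-Lipschitz way. The triangle inequality carries measurability to the limit. -/
theorem measurable_skorokhodDist {Ω E : Type*} [MeasurableSpace Ω] [PseudoEMetricSpace E]
    [MeasurableSpace E] [BorelSpace E] [SecondCountableTopology E] {T : ℕ} {Z : Ω → ℝ≥0 → E}
    (hZ : ∀ t, Measurable fun ω => Z ω t) (hn : ∀ ω, HasFineNodes T (Z ω)) (z : ℝ≥0 → E) :
    Measurable fun ω => skorokhodDist T (Z ω) z := by
  set W : ℕ → Ω → ℝ≥0 → E := fun m ω t => Z ω (⌊((m : ℝ≥0) + 1) * t⌋₊ / (m + 1))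
  refine measurable_of_tendsto_metrizable (f := fun m ω => skorokhodDist T (W m ω) z)
    (fun m => ?_) (tendsto_pi_nhds.2 fun ω => ?_)
  · set N := (m + 1) * T
    -- The minimum only keeps the index in range for times beyond `T`.
    set k : ℝ≥0 → Fin (N + 1) := fun t => ⟨min ⌊((m : ℝ≥0) + 1) * t⌋₊ N, by omega⟩
    have heq : (fun ω => skorokhodDist T (W m ω) z) =
        (fun v : Fin (N + 1) → E => skorokhodDist T (fun t => v (k t)) z) ∘
          fun ω (j : Fin (N + 1)) => Z ω ((j : ℕ) / (m + 1)) := by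
      have hk : ∀ ω, ∀ t ≤ (T : ℝ≥0), W m ω t = Z ω (((k t : Fin (N + 1)) : ℕ) / (m + 1)) := by
        intro ω t ht
        simp only [W, k]
        rw [min_eq_left]
        refine (Nat.floor_mono (mul_le_mul_right ht _)).trans ?_
        have : ((m : ℝ≥0) + 1) * T = (N : ℕ) := by simp [N]
        rw [this, Nat.floor_natCast]
      funext ω
      refine le_antisymm ?_ ?_
      · refine (skorokhodDist_congr_left z (c := 0) fun t ht => ?_).trans (add_zero _).le
        rw [hk ω t ht, edist_self]
      · refine (skorokhodDist_congr_left z (c := 0) fun t ht => ?_).trans (add_zero _).le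
        rw [hk ω t ht, edist_self]
    rw [heq]
    exact (continuous_skorokhodDist_step T (N + 1) k z).measurable.comp
      (measurable_pi_lambda _ fun j => hZ _)
  · have h0 := (hn ω).tendsto_skorokhodDist
    refine tendsto_of_tendsto_of_tendsto_of_le_of_le
      (g := fun m => skorokhodDist T (Z ω) z - skorokhodDist T (Z ω) (W m ω))
      (h := fun m => skorokhodDist T (Z ω) (W m ω) + skorokhodDist T (Z ω) z) ?_ ?_
      (fun m => ?_) fun m => ?_
    · simpa using ENNReal.Tendsto.sub (tendsto_const_nhds (x := skorokhodDist T (Z ω) z)) h0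
        (Or.inr (by simp))
    · simpa using h0.add (tendsto_const_nhds (x := skorokhodDist T (Z ω) z))
    · rw [tsub_le_iff_left]
      exact skorokhodDist_triangle _ _ _ _
    · simp only
      rw [skorokhodDist_comm T (Z ω) (W m ω)]
      exact skorokhodDist_triangle _ _ _ _

/-! ### Structure of a single path: passages, cycles, fine nodes -/

/-- The formula for the ON path started at `(s, v)`, without the truncation before `s`. -/
noncomputable def onCurve (q : Params) (ε : ℝ) (I : ℝ≥0 → ℝ) (s : ℝ≥0) (v : ℝ) (t : ℝ≥0) : ℝ :=
  q.β / q.αon + (v - q.β / q.αon) * Real.exp (-q.αon * (t - s))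
    + ε * Real.exp (-q.αon * t) * (I t - I s)

section

variable {q : Params} {ε : ℝ} {I : ℝ≥0 → ℝ} {x₀ v : ℝ} {s t : ℝ≥0}

theorem onPath_coe (hst : s ≤ t) : onPath q ε I s v t = onCurve q ε I s v t := by
  have h : (s : ℝ≥0∞) ≤ t := by exact_mod_cast hst
  rw [onPath, if_pos h, onCurve, min_eq_right h]
  simp

theorem onCurve_self : onCurve q ε I s v s = v := by simp [onCurve]

theorem continuous_onCurve (hI : Continuous I) : Continuous (onCurve q ε I s v) := by
  unfold onCurve
  fun_prop

/-- The formula for the OFF path started at time `τ`, without the truncation before `τ`. -/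
noncomputable def offCurve (q : Params) (τ t : ℝ≥0) : ℝ :=
  q.xref * Real.exp (-q.αoff * (t - τ))

theorem offPath_coe {τ : ℝ≥0} (h : τ ≤ t) : offPath q τ t = offCurve q τ t := by
  rw [offPath, if_pos (by exact_mod_cast h)]
  simp [offCurve]

theorem continuous_offCurve {τ : ℝ≥0} : Continuous (offCurve q τ) := by
  unfold offCurve
  fun_prop

theorem passageTime_top : passageTime q ε I ∞ v = ∞ := by
  simp [passageTime]

/-- The level set is closed, so a finite infimum is attained; by the intermediate value theorem a
path starting below the level stays below it until then. -/
theorem passageTime_cases (hI : Continuous I) (hv : v < q.xref) :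
    (passageTime q ε I s v = ∞ ∧ ∀ t, s ≤ t → onCurve q ε I s v t < q.xref) ∨
    ∃ t : ℝ≥0, s < t ∧ passageTime q ε I s v = t ∧ onCurve q ε I s v t = q.xref ∧
      ∀ r, s ≤ r → r < t → onCurve q ε I s v r < q.xref := by
  set g := onCurve q ε I s v
  have hg : Continuous g := continuous_onCurve hI
  have hgs : g s = v := onCurve_self
  set H : Set ℝ≥0 := {t | s ≤ t ∧ g t = q.xref}
  have hHs : ∀ t ∈ H, s < t := fun t ht => lt_of_le_of_ne ht.1 fun h => by
    have := ht.2
    rw [← h, hgs] at this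
    exact hv.ne this
  have hHc : IsClosed H := isClosed_Ici.inter (isClosed_singleton.preimage hg)
  have hivt : ∀ r, s ≤ r → q.xref ≤ g r → ∃ t ∈ H, t ≤ r := fun r hr h => by
    obtain ⟨t, ht, hgt⟩ := intermediate_value_Icc hr hg.continuousOn ⟨hgs.trans_le hv.le, h⟩
    exact ⟨t, ⟨ht.1, hgt⟩, ht.2⟩
  have hpass : passageTime q ε I s v = sInf ((fun t : ℝ≥0 => (t : ℝ≥0∞)) '' H) := by
    unfold passageTime
    congr 1
    ext x
    constructor
    · rintro ⟨t, rfl, hst, ht⟩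
      have hst' : s < t := by exact_mod_cast hst
      rw [onPath_coe hst'.le] at ht
      exact ⟨t, ⟨hst'.le, ht⟩, rfl⟩
    · rintro ⟨t, ht, rfl⟩
      exact ⟨t, rfl, by exact_mod_cast hHs t ht, by rw [onPath_coe ht.1]; exact ht.2⟩
  rcases H.eq_empty_or_nonempty with h | h
  · left
    refine ⟨by rw [hpass, h]; simp, fun t ht => ?_⟩
    by_contra! hcon
    obtain ⟨r, hr, -⟩ := hivt t ht hcon
    simp [h] at hr
  · right
    have hmem := hHc.csInf_mem h (OrderBot.bddBelow _)
    refine ⟨sInf H, hHs _ hmem, ?_, hmem.2, fun r hr hrt => ?_⟩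
    · rw [hpass]
      refine IsLeast.csInf_eq ⟨⟨_, hmem, rfl⟩, ?_⟩
      rintro _ ⟨t, ht, rfl⟩
      exact ENNReal.coe_le_coe.2 (csInf_le (OrderBot.bddBelow _) ht)
    · by_contra! hcon
      obtain ⟨t, ht, htr⟩ := hivt r hr hcon
      exact absurd (csInf_le (OrderBot.bddBelow _) ht) (not_le.2 (htr.trans_lt hrt))

theorem nextPulse_top : nextPulse ∞ = ∞ := by simp [nextPulse]

theorem nextPulse_coe (t : ℝ≥0) : nextPulse t = ((⌊t⌋₊ + 1 : ℕ) : ℝ≥0∞) := by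
  refine IsLeast.csInf_eq ⟨⟨?_, _, rfl⟩, ?_⟩
  · have : t < ((⌊t⌋₊ + 1 : ℕ) : ℝ≥0) := by exact_mod_cast Nat.lt_floor_add_one t
    exact_mod_cast this
  · rintro _ ⟨h, k, rfl⟩
    have h' : t < (k : ℝ≥0) := by exact_mod_cast h
    have : ⌊t⌋₊ < k := (Nat.floor_lt zero_le).2 h'
    exact_mod_cast this

theorem σtime_zero : σtime q ε I x₀ 0 = 0 := rfl

theorem τtime_eq (n : ℕ) : τtime q ε I x₀ n =
    passageTime q ε I (σtime q ε I x₀ n) (cycleStart q ε I x₀ n).2 := rfl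

theorem σtime_succ (n : ℕ) : σtime q ε I x₀ (n + 1) = nextPulse (τtime q ε I x₀ n) := rfl

theorem cycleStart_succ_snd (n : ℕ) : (cycleStart q ε I x₀ (n + 1)).2 =
    offPath q (τtime q ε I x₀ n) (nextPulse (τtime q ε I x₀ n)).toNNReal := rfl

theorem cycleStart_succ_snd_of_coe {n : ℕ} (h : τtime q ε I x₀ n = t) :
    (cycleStart q ε I x₀ (n + 1)).2 = offCurve q t (⌊t⌋₊ + 1 : ℕ) := by
  have h1 : t ≤ ((⌊t⌋₊ + 1 : ℕ) : ℝ≥0) := by exact_mod_cast (Nat.lt_floor_add_one t).le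
  rw [cycleStart_succ_snd, h, nextPulse_coe, ENNReal.toNNReal_natCast, offPath_coe h1]

theorem σtime_mono : Monotone (σtime q ε I x₀) := monotone_nat_of_le_succ fun n =>
  (σtime_le_τtime q ε I x₀ n).trans (τtime_le_σtime_succ q ε I x₀ n)

theorem offCurve_mem (hxr : 0 < q.xref) (hα : 0 < q.αoff) {τ : ℝ≥0} (h : τ ≤ t) :
    0 ≤ offCurve q τ t ∧ offCurve q τ t ≤ q.xref ∧ (τ < t → offCurve q τ t < q.xref) := by
  have h' : (0 : ℝ) ≤ t - τ := sub_nonneg.2 h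
  refine ⟨by unfold offCurve; positivity, ?_, fun h => ?_⟩
  · exact mul_le_of_le_one_right hxr.le (Real.exp_le_one_iff.2 (by nlinarith))
  · have h' : (0 : ℝ) < t - τ := sub_pos.2 h
    exact mul_lt_of_lt_one_right hxr (Real.exp_lt_one_iff.2 (by nlinarith))

/-- The next pulse comes strictly after the passage, so the OFF decay has brought the value strictly
below `xref`. This is what makes `passageTime_cases` available in the next cycle. -/
theorem cycleStart_cases (hq : q.Admissible) (hI : Continuous I) (hx : 0 ≤ x₀)
    (hx' : x₀ < q.xref) (n : ℕ) :
    (σtime q ε I x₀ n = ∞ ∨ ∃ k : ℕ, n ≤ k ∧ σtime q ε I x₀ n = k) ∧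
      0 ≤ (cycleStart q ε I x₀ n).2 ∧ (cycleStart q ε I x₀ n).2 < q.xref := by
  induction n with
  | zero => exact ⟨Or.inr ⟨0, le_rfl, by simp [σtime_zero]⟩, hx, hx'⟩
  | succ n ih =>
    obtain ⟨hσ, h0, h1⟩ := ih
    have hτ : τtime q ε I x₀ n = ∞ ∨ ∃ t : ℝ≥0, τtime q ε I x₀ n = t ∧ (n : ℝ≥0) ≤ t := by
      rcases hσ with hσ | ⟨k, hk, hσ⟩
      · left; rw [τtime_eq, hσ, passageTime_top]
      · rw [τtime_eq, hσ]
        rcases passageTime_cases (ε := ε) (s := (k : ℝ≥0)) hI h1 with ⟨h, -⟩ | ⟨t, hst, h, -⟩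
        · left; exact_mod_cast h
        · exact Or.inr ⟨t, by exact_mod_cast h, le_trans (by exact_mod_cast hk) hst.le⟩
    rcases hτ with hτ | ⟨t, hτ, hnt⟩
    · rw [σtime_succ, hτ, nextPulse_top]
      -- After an infinite passage time the carried value is the default `0` of `offPath`, which
      -- still lies in `[0, xref)`.
      have : (cycleStart q ε I x₀ (n + 1)).2 = 0 := by
        rw [cycleStart_succ_snd, hτ, nextPulse_top]
        simp [offPath]
      rw [this]
      exact ⟨Or.inl rfl, le_rfl, hq.xref_pos⟩
    · have hlt : t < ((⌊t⌋₊ + 1 : ℕ) : ℝ≥0) := by exact_mod_cast Nat.lt_floor_add_one t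
      obtain ⟨h2, -, h3⟩ := offCurve_mem hq.xref_pos hq.αoff_pos hlt.le
      rw [cycleStart_succ_snd_of_coe hτ, σtime_succ, hτ, nextPulse_coe]
      exact ⟨Or.inr ⟨_, Nat.succ_le_succ (Nat.le_floor hnt), rfl⟩, h2, h3 hlt⟩

theorem natCast_le_σtime (hq : q.Admissible) (hI : Continuous I) (hx : 0 ≤ x₀)
    (hx' : x₀ < q.xref) (n : ℕ) : (n : ℝ≥0∞) ≤ σtime q ε I x₀ n := by
  rcases (cycleStart_cases (ε := ε) hq hI hx hx' n).1 with h | ⟨k, hk, h⟩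
  · simp [h]
  · rw [h]; exact_mod_cast hk

theorem exists_cycle (hq : q.Admissible) (hI : Continuous I) (hx : 0 ≤ x₀)
    (hx' : x₀ < q.xref) (t : ℝ≥0) :
    ∃ n : ℕ, (n : ℝ≥0) ≤ t ∧ σtime q ε I x₀ n ≤ t ∧ (t : ℝ≥0∞) < σtime q ε I x₀ (n + 1) := by
  classical
  have hex : ∃ n, (t : ℝ≥0∞) < σtime q ε I x₀ n := by
    refine ⟨⌊t⌋₊ + 1, lt_of_lt_of_le ?_ (natCast_le_σtime hq hI hx hx' _)⟩
    have : t < ((⌊t⌋₊ + 1 : ℕ) : ℝ≥0) := by exact_mod_cast Nat.lt_floor_add_one t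
    exact_mod_cast this
  obtain ⟨n, hn⟩ : ∃ n, Nat.find hex = n + 1 := Nat.exists_eq_succ_of_ne_zero fun h => by
    have := Nat.find_spec hex
    rw [h, σtime_zero] at this
    simp at this
  have h1 : σtime q ε I x₀ n ≤ t := not_lt.1 (Nat.find_min hex (by omega))
  refine ⟨n, ?_, h1, hn ▸ Nat.find_spec hex⟩
  exact_mod_cast (natCast_le_σtime hq hI hx hx' n).trans h1

theorem notMem_cycle {n m : ℕ} (hmn : m ≠ n) (h1 : σtime q ε I x₀ n ≤ t)
    (h2 : (t : ℝ≥0∞) < σtime q ε I x₀ (n + 1)) :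
    (t : ℝ≥0∞) ∉ Ico (σtime q ε I x₀ m) (τtime q ε I x₀ m) ∧
      (t : ℝ≥0∞) ∉ Ico (τtime q ε I x₀ m) (σtime q ε I x₀ (m + 1)) := by
  have h : (t : ℝ≥0∞) ∉ Ico (σtime q ε I x₀ m) (σtime q ε I x₀ (m + 1)) := fun hm => by
    rcases lt_or_gt_of_ne hmn with hlt | hlt
    · exact absurd (h1.trans_lt hm.2) (not_lt.2 (σtime_mono hlt))
    · exact absurd (hm.1.trans_lt h2) (not_lt.2 (σtime_mono hlt))
  exact ⟨fun hm => h ⟨hm.1, hm.2.trans_le (τtime_le_σtime_succ q ε I x₀ m)⟩,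
    fun hm => h ⟨(σtime_le_τtime q ε I x₀ m).trans hm.1, hm.2⟩⟩

theorem xPath_eq {n : ℕ} (h1 : σtime q ε I x₀ n ≤ t)
    (h2 : (t : ℝ≥0∞) < σtime q ε I x₀ (n + 1)) :
    xPath q ε I x₀ t = if (t : ℝ≥0∞) < τtime q ε I x₀ n then
      onPath q ε I (σtime q ε I x₀ n) (cycleStart q ε I x₀ n).2 t
      else offPath q (τtime q ε I x₀ n) t := by
  rw [xPath, tsum_eq_single n]
  · split_ifs with h
    · rw [indicator_of_mem (mem_Ico.2 ⟨h1, h⟩), indicator_of_notMem fun h' => absurd h (not_lt.2 h'.1)]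
      simp
    · rw [indicator_of_notMem fun h' => h h'.2, indicator_of_mem (mem_Ico.2 ⟨not_lt.1 h, h2⟩)]
      simp
  · intro m hm
    obtain ⟨h3, h4⟩ := notMem_cycle hm h1 h2
    rw [indicator_of_notMem h3, indicator_of_notMem h4]
    simp

theorem yPath_eq {n : ℕ} (h1 : σtime q ε I x₀ n ≤ t)
    (h2 : (t : ℝ≥0∞) < σtime q ε I x₀ (n + 1)) :
    yPath q ε I x₀ t = if (t : ℝ≥0∞) < τtime q ε I x₀ n then 1 else 0 := by
  rw [yPath, tsum_eq_single n]
  · split_ifs with h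
    · rw [indicator_of_mem (mem_Ico.2 ⟨h1, h⟩)]
      simp
    · rw [indicator_of_notMem fun h' => h h'.2]
  · intro m hm
    rw [indicator_of_notMem (notMem_cycle hm h1 h2).1]

theorem edist_statePath_le {ε' : ℝ} {I' : ℝ≥0 → ℝ} {x₀' : ℝ} {c : ℝ}
    (h : |xPath q ε I x₀ s - xPath q ε' I' x₀' t| + |yPath q ε I x₀ s - yPath q ε' I' x₀' t| ≤ c) :
    edist (statePath q ε I x₀ s) (statePath q ε' I' x₀' t) ≤ ENNReal.ofReal c := by
  rw [edist_dist]
  refine ENNReal.ofReal_le_ofReal (le_trans ?_ h)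
  rw [Subtype.dist_eq, EuclideanSpace.dist_eq]
  refine Real.sqrt_le_iff.2 ⟨by positivity, ?_⟩
  simp only [statePath, Fin.sum_univ_two, Real.dist_eq]
  simp
  nlinarith [sq_abs (xPath q ε I x₀ s - xPath q ε' I' x₀' t), mul_nonneg (abs_nonneg (xPath q ε I x₀ s - xPath q ε' I' x₀' t)) (abs_nonneg (yPath q ε I x₀ s - yPath q ε' I' x₀' t)),
    sq_abs (yPath q ε I x₀ s - yPath q ε' I' x₀' t)]

theorem eventually_forall_dist_le {g : ℝ≥0 → ℝ} (hg : Continuous g) (T : ℝ≥0) {δ : ℝ}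
    (hδ : 0 < δ) : ∀ᶠ m : ℕ in atTop, ∀ s ≤ T, ∀ t ≤ T, dist s t ≤ 1 / ((m : ℝ) + 1) →
      |g s - g t| ≤ δ := by
  have hu := (isCompact_Icc (a := (0 : ℝ≥0)) (b := T)).uniformContinuousOn_of_continuous
    hg.continuousOn
  obtain ⟨η, hη, h⟩ := Metric.uniformContinuousOn_iff.1 hu δ hδ
  filter_upwards [tendsto_one_div_add_atTop_nhds_zero_nat.eventually (gt_mem_nhds hη)]
    with m hm s hs t ht hst
  exact (h s ⟨zero_le, hs⟩ t ⟨zero_le, ht⟩ (hst.trans_lt hm)).le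

/-- Two times on the same side of all switching times belong to the same cycle and mode, so the
states differ only through one continuous piece. A fine uniform grid among the nodes makes that
piece vary by at most `δ`. -/
theorem hasFineNodes_statePath (hq : q.Admissible) (hI : Continuous I) (hx : 0 ≤ x₀)
    (hx' : x₀ < q.xref) (T : ℕ) : HasFineNodes T (statePath q ε I x₀) := by
  classical
  intro δ hδ
  set on : ℕ → ℝ≥0 → ℝ := fun n =>
    onCurve q ε I (σtime q ε I x₀ n).toNNReal (cycleStart q ε I x₀ n).2
  set off : ℕ → ℝ≥0 → ℝ := fun n => offCurve q (τtime q ε I x₀ n).toNNReal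
  have hev : ∀ᶠ m : ℕ in atTop, ∀ n ∈ Finset.range (T + 1), ∀ s ≤ (T : ℝ≥0), ∀ t ≤ (T : ℝ≥0),
      dist s t ≤ 1 / ((m : ℝ) + 1) → |on n s - on n t| ≤ δ ∧ |off n s - off n t| ≤ δ := by
    refine (eventually_all_finset _).2 fun n _ => ?_
    filter_upwards [eventually_forall_dist_le (continuous_onCurve hI) T (by exact_mod_cast hδ),
      eventually_forall_dist_le continuous_offCurve T (by exact_mod_cast hδ)]
      with m h1 h2 s hs t ht hst
    exact ⟨h1 s hs t ht hst, h2 s hs t ht hst⟩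
  obtain ⟨m, hm⟩ := hev.exists
  -- Finitely many switching times suffice, since cycle `n` starts no earlier than time `n`. An
  -- infinite one contributes the node `0`, which does no harm.
  set A : Finset ℝ≥0 := {0, (T : ℝ≥0)} ∪
    ((Finset.range (T + 2)).image (fun n => (σtime q ε I x₀ n).toNNReal) ∪
    ((Finset.range (T + 1)).image (fun n => (τtime q ε I x₀ n).toNNReal) ∪
    (Finset.range ((m + 1) * T + 1)).image (fun j : ℕ => (j : ℝ≥0) / (m + 1))))
  refine ⟨A, by simp [A], by simp [A], fun s hs t ht hst => ?_⟩
  have hiff : ∀ x : ℝ≥0∞, x.toNNReal ∈ A → (x ≤ s ↔ x ≤ t) := fun x hxA => by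
    rcases eq_or_ne x ∞ with h | h
    · simp [h]
    · lift x to ℝ≥0 using h
      have := hst x (by simpa using hxA)
      exact_mod_cast this
  have hdist : dist s t ≤ 1 / ((m : ℝ) + 1) := by
    set M : ℝ≥0 := m + 1 with hM
    have hM0 : 0 < M := by positivity
    have hfl : ∀ r r' : ℝ≥0, r ≤ T → (∀ a ∈ A, a ≤ r ↔ a ≤ r') → ⌊M * r⌋₊ ≤ M * r' := by
      intro r r' hr h
      have h1 : ((⌊M * r⌋₊ : ℝ≥0) / M) ≤ r := by
        rw [div_le_iff₀ hM0, mul_comm r]; exact Nat.floor_le zero_le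
      have h2 : ((⌊M * r⌋₊ : ℝ≥0) / M) ∈ A := by
        refine Finset.mem_union_right _ (Finset.mem_union_right _ (Finset.mem_union_right _ ?_))
        refine Finset.mem_image.2 ⟨⌊M * r⌋₊, Finset.mem_range.2 (Nat.lt_succ_of_le ?_), rfl⟩
        refine Nat.floor_le_of_le ?_
        calc M * r ≤ M * T := by gcongr
          _ = _ := by rw [hM]; push_cast; ring
      have h3 := (h _ h2).1 h1
      rwa [div_le_iff₀ hM0, mul_comm r'] at h3
    have h1 := hfl s t hs hst
    have h2 := hfl t s ht fun a ha => (hst a ha).symm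
    have h3 := Nat.lt_floor_add_one (M * s)
    have h4 := Nat.lt_floor_add_one (M * t)
    have h5 : M * s ≤ M * t + 1 := h3.le.trans (by gcongr)
    have h6 : M * t ≤ M * s + 1 := h4.le.trans (by gcongr)
    have h5' : (M : ℝ) * s ≤ M * t + 1 := by exact_mod_cast h5
    have h6' : (M : ℝ) * t ≤ M * s + 1 := by exact_mod_cast h6
    have hMr : (M : ℝ) = m + 1 := by rw [hM]; push_cast; rfl
    have hMr0 : (0 : ℝ) < M := by exact_mod_cast hM0
    rw [← hMr, NNReal.dist_eq, le_div_iff₀ hMr0]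
    conv_lhs => rw [← abs_of_pos hMr0, ← abs_mul]
    exact abs_le.2 ⟨by nlinarith, by nlinarith⟩
  obtain ⟨n, hn, h1, h2⟩ := exists_cycle (ε := ε) hq hI hx hx' s
  have hnT : n ≤ T := by exact_mod_cast hn.trans hs
  have hσA : ∀ n ≤ T + 1, (σtime q ε I x₀ n).toNNReal ∈ A := fun n hn =>
    Finset.mem_union_right _ (Finset.mem_union_left _
      (Finset.mem_image.2 ⟨n, Finset.mem_range.2 (by omega), rfl⟩))
  have hτA : (τtime q ε I x₀ n).toNNReal ∈ A :=
    Finset.mem_union_right _ (Finset.mem_union_right _ (Finset.mem_union_left _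
      (Finset.mem_image.2 ⟨n, Finset.mem_range.2 (by omega), rfl⟩)))
  have h1' := (hiff _ (hσA n (by omega))).1 h1
  have h2' : (t : ℝ≥0∞) < σtime q ε I x₀ (n + 1) := by
    rw [← not_le] at h2 ⊢
    rwa [← hiff _ (hσA (n + 1) (by omega))]
  have h3 : (s : ℝ≥0∞) < τtime q ε I x₀ n ↔ (t : ℝ≥0∞) < τtime q ε I x₀ n := by
    rw [← not_le, ← not_le, hiff _ hτA]
  rw [← ENNReal.ofReal_coe_nnreal]
  apply edist_statePath_le
  rw [xPath_eq h1 h2, xPath_eq h1' h2', yPath_eq h1 h2, yPath_eq h1' h2']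
  have hon : ∀ r : ℝ≥0, σtime q ε I x₀ n ≤ r →
      onPath q ε I (σtime q ε I x₀ n) (cycleStart q ε I x₀ n).2 r = on n r := fun r hr => by
    have hfin : σtime q ε I x₀ n ≠ ∞ := ne_top_of_le_ne_top ENNReal.coe_ne_top hr
    have hc := ENNReal.coe_toNNReal hfin
    rw [← hc, onPath_coe (by rw [← hc] at hr; exact_mod_cast hr)]
  have hoff : ∀ r : ℝ≥0, τtime q ε I x₀ n ≤ r →
      offPath q (τtime q ε I x₀ n) r = off n r := fun r hr => by
    have hfin : τtime q ε I x₀ n ≠ ∞ := ne_top_of_le_ne_top ENNReal.coe_ne_top hr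
    have hc := ENNReal.coe_toNNReal hfin
    rw [← hc, offPath_coe (by rw [← hc] at hr; exact_mod_cast hr)]
  have hmn := hm n (Finset.mem_range.2 (by omega)) s hs t ht hdist
  by_cases h : (s : ℝ≥0∞) < τtime q ε I x₀ n
  · rw [if_pos h, if_pos (h3.1 h), if_pos h, if_pos (h3.1 h), hon s h1, hon t h1', sub_self,
      abs_zero, add_zero]
    exact hmn.1
  · have h' := h3.not.1 h
    rw [if_neg h, if_neg h', if_neg h, if_neg h', hoff s (not_lt.1 h), hoff t (not_lt.1 h'),
      sub_self, abs_zero, add_zero]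
    exact hmn.2

end

/-! ### Measurability of the switching process -/

section

variable {Ω : Type*} [MeasurableSpace Ω] {q : Params} {ε : ℝ} {I : ℝ≥0 → Ω → ℝ}

theorem measurable_comp_process (hm : ∀ t, Measurable (I t))
    (hc : ∀ ω, Continuous fun t => I t ω) {g : Ω → ℝ≥0} (hg : Measurable g) :
    Measurable fun ω => I (g ω) ω := by
  have h := measurable_uncurry_of_continuous_of_measurable (u := fun t ω => I t ω) hc hm
  exact h.comp (hg.prodMk measurable_id)

theorem measurable_onPath (hm : ∀ t, Measurable (I t)) (hc : ∀ ω, Continuous fun t => I t ω)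
    {σ : Ω → ℝ≥0∞} (hσ : Measurable σ) {v : Ω → ℝ} (hv : Measurable v) (t : ℝ≥0) :
    Measurable fun ω => onPath q ε (fun t => I t ω) (σ ω) (v ω) t := by
  unfold onPath
  have h1 : Measurable fun ω => I (min (t : ℝ≥0∞) (σ ω)).toNNReal ω :=
    measurable_comp_process hm hc (measurable_const.min hσ).ennreal_toNNReal
  refine Measurable.ite (measurableSet_le hσ measurable_const) ?_ measurable_const
  exact ((hv.sub_const _).mul (Real.measurable_exp.comp
    ((hσ.ennreal_toReal.const_sub _).const_mul _))).const_add _ |>.add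
      (((hm t).sub h1).const_mul _)

theorem measurable_offPath {τ : Ω → ℝ≥0∞} (hτ : Measurable τ) {g : Ω → ℝ≥0} (hg : Measurable g) :
    Measurable fun ω => offPath q (τ ω) (g ω) := by
  unfold offPath
  refine Measurable.ite (measurableSet_le hτ hg.coe_nnreal_ennreal) ?_ measurable_const
  have := hτ.ennreal_toReal
  fun_prop

/-- By compactness, a path that has not reached the level on `[σ, t]` stays below it by a uniform
margin, and by continuity such a margin can be tested on a dense set. For countable `D` the event is
therefore a countable combination of events at fixed times. -/
theorem coe_lt_passageTime_iff {D : Set ℝ≥0} (hD : Dense D) {I : ℝ≥0 → ℝ} (hI : Continuous I)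
    {σ : ℝ≥0∞} {v : ℝ} (hv : v < q.xref) {t : ℝ≥0} :
    (t : ℝ≥0∞) < passageTime q ε I σ v ↔ t < σ ∨ ∃ k : ℕ, ∀ r ∈ D, r ≤ t → σ ≤ r →
      onPath q ε I σ v r ≤ q.xref - 1 / ((k : ℝ) + 1) := by
  rcases eq_or_ne σ ∞ with rfl | h
  · simp [passageTime_top]
  lift σ to ℝ≥0 using h with s
  constructor
  · intro h
    refine or_iff_not_imp_left.2 fun hst => ?_
    have hst' : s ≤ t := by exact_mod_cast not_lt.1 hst
    have hlt : ∀ r ∈ Icc s t, onCurve q ε I s v r < q.xref := fun r hr => by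
      rcases passageTime_cases (ε := ε) (s := s) hI hv with ⟨-, h2⟩ | ⟨t', -, h2, -, h3⟩
      · exact h2 r hr.1
      · rw [h2] at h
        exact h3 r hr.1 (hr.2.trans_lt (by exact_mod_cast h))
    obtain ⟨m, hm, hmax⟩ := isCompact_Icc.exists_isMaxOn (nonempty_Icc.2 hst')
      (continuous_onCurve (q := q) (ε := ε) (s := s) (v := v) hI).continuousOn
    obtain ⟨k, hk⟩ := exists_nat_one_div_lt (sub_pos.2 (hlt m hm))
    refine ⟨k, fun r _ hrt hsr => ?_⟩
    have hsr' : s ≤ r := by exact_mod_cast hsr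
    rw [onPath_coe hsr']
    have := hmax (a := r) ⟨hsr', hrt⟩
    simp only [mem_ofPred_eq] at this
    linarith
  · rintro (h | ⟨k, hk⟩)
    · exact h.trans_le (le_sInf fun x ⟨r, hx, hr, _⟩ => hx ▸ hr.le)
    · by_contra hcon
      rw [not_lt] at hcon
      rcases passageTime_cases (ε := ε) (s := s) hI hv with ⟨h2, -⟩ | ⟨t', hst, h2, h3, -⟩
      · simp [h2] at hcon
      · rw [h2] at hcon
        have htt : t' ≤ t := by exact_mod_cast hcon
        have hpos : (0 : ℝ) < 1 / ((k : ℝ) + 1) := by positivity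
        have hnear : ∀ᶠ r in 𝓝[<] t', q.xref - 1 / ((k : ℝ) + 1) < onCurve q ε I s v r ∧
            s < r ∧ r < t' := by
          refine Eventually.and ?_ (Ioo_mem_nhdsLT hst)
          exact nhdsWithin_le_nhds ((continuous_onCurve hI).continuousAt.eventually
            (lt_mem_nhds (by rw [h3]; linarith)))
        obtain ⟨l, hl, hlt⟩ := (mem_nhdsLT_iff_exists_Ioo_subset' hst).1 hnear
        obtain ⟨r, hrD, hr⟩ := hD.exists_between hl
        obtain ⟨h4, h5, h6⟩ := hlt hr
        have := hk r hrD (h6.le.trans htt) (by exact_mod_cast h5.le)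
        rw [onPath_coe h5.le] at this
        linarith

theorem measurable_passageTime (hm : ∀ t, Measurable (I t)) (hc : ∀ ω, Continuous fun t => I t ω)
    {σ : Ω → ℝ≥0∞} (hσ : Measurable σ) {v : Ω → ℝ} (hv : Measurable v) (hvx : ∀ ω, v ω < q.xref) :
    Measurable fun ω => passageTime q ε (fun t => I t ω) (σ ω) (v ω) := by
  obtain ⟨D, hDc, hD⟩ := TopologicalSpace.exists_countable_dense ℝ≥0
  refine measurable_of_Ioi fun a => ?_
  rcases eq_or_ne a ∞ with rfl | h
  · simp
  lift a to ℝ≥0 using h with t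
  have : (fun ω => passageTime q ε (fun t => I t ω) (σ ω) (v ω)) ⁻¹' Ioi ↑t =
      {ω | (t : ℝ≥0∞) < σ ω} ∪ ⋃ k : ℕ, ⋂ r ∈ D, {ω | r ≤ t → σ ω ≤ r →
        onPath q ε (fun t => I t ω) (σ ω) (v ω) r ≤ q.xref - 1 / ((k : ℝ) + 1)} := by
    ext ω
    simp only [mem_preimage, mem_Ioi, coe_lt_passageTime_iff hD (hc ω) (hvx ω), mem_union,
      mem_ofPred_eq, mem_iUnion, mem_iInter]
  rw [this]
  refine (measurableSet_lt measurable_const hσ).union (MeasurableSet.iUnion fun k =>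
    MeasurableSet.biInter hDc fun r _ => ?_)
  by_cases hr : r ≤ t
  · simp only [hr, true_imp_iff]
    exact MeasurableSet.imp (measurableSet_le hσ measurable_const)
      (measurableSet_le (measurable_onPath hm hc hσ hv r) measurable_const)
  · simp [hr]

theorem monotone_nextPulse : Monotone nextPulse := fun _ _ h =>
  sInf_le_sInf fun _ hs => ⟨h.trans_lt hs.1, hs.2⟩

variable {x₀ : ℝ}

theorem measurable_cycleStart (hq : q.Admissible) (hm : ∀ t, Measurable (I t))
    (hc : ∀ ω, Continuous fun t => I t ω) (hx : 0 ≤ x₀) (hx' : x₀ < q.xref) (n : ℕ) :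
    (Measurable fun ω => σtime q ε (fun t => I t ω) x₀ n) ∧
      (Measurable fun ω => (cycleStart q ε (fun t => I t ω) x₀ n).2) ∧
      Measurable fun ω => τtime q ε (fun t => I t ω) x₀ n := by
  have hτ : ∀ n, (Measurable fun ω => σtime q ε (fun t => I t ω) x₀ n) →
      (Measurable fun ω => (cycleStart q ε (fun t => I t ω) x₀ n).2) →
      Measurable fun ω => τtime q ε (fun t => I t ω) x₀ n := fun n h1 h2 =>
    measurable_passageTime hm hc h1 h2 fun ω => (cycleStart_cases hq (hc ω) hx hx' n).2.2
  induction n with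
  | zero =>
    have h1 : Measurable fun ω => σtime q ε (fun t => I t ω) x₀ 0 := measurable_const
    have h2 : Measurable fun ω => (cycleStart q ε (fun t => I t ω) x₀ 0).2 := measurable_const
    exact ⟨h1, h2, hτ 0 h1 h2⟩
  | succ n ih =>
    have h1 : Measurable fun ω => σtime q ε (fun t => I t ω) x₀ (n + 1) :=
      monotone_nextPulse.measurable.comp ih.2.2
    have h2 : Measurable fun ω => (cycleStart q ε (fun t => I t ω) x₀ (n + 1)).2 :=
      measurable_offPath ih.2.2 h1.ennreal_toNNReal
    exact ⟨h1, h2, hτ (n + 1) h1 h2⟩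

theorem measurable_statePath (hq : q.Admissible) (hm : ∀ t, Measurable (I t))
    (hc : ∀ ω, Continuous fun t => I t ω) (hx : 0 ≤ x₀) (hx' : x₀ < q.xref) (t : ℝ≥0) :
    Measurable fun ω => statePath q ε (fun t => I t ω) x₀ t := by
  have hind : ∀ n, (Measurable fun ω => (Ico (σtime q ε (fun t => I t ω) x₀ n)
        (τtime q ε (fun t => I t ω) x₀ n)).indicator (1 : ℝ≥0∞ → ℝ) t) ∧
      (Measurable fun ω => (Ico (τtime q ε (fun t => I t ω) x₀ n)
        (σtime q ε (fun t => I t ω) x₀ (n + 1))).indicator (1 : ℝ≥0∞ → ℝ) t) := fun n => by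
    obtain ⟨h1, -, h3⟩ := measurable_cycleStart (ε := ε) hq hm hc hx hx' n
    obtain ⟨h4, -, -⟩ := measurable_cycleStart (ε := ε) hq hm hc hx hx' (n + 1)
    classical
    simp only [indicator_apply, mem_Ico]
    exact ⟨Measurable.ite ((measurableSet_le h1 measurable_const).inter
      (measurableSet_lt measurable_const h3)) measurable_const measurable_const,
      Measurable.ite ((measurableSet_le h3 measurable_const).inter
      (measurableSet_lt measurable_const h4)) measurable_const measurable_const⟩
  have hfin : ∀ ω, ∀ n ∉ Finset.range (⌊t⌋₊ + 1), (t : ℝ≥0∞) ∉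
      Ico (σtime q ε (fun t => I t ω) x₀ n) (τtime q ε (fun t => I t ω) x₀ n) ∧ (t : ℝ≥0∞) ∉
      Ico (τtime q ε (fun t => I t ω) x₀ n) (σtime q ε (fun t => I t ω) x₀ (n + 1)) := by
    intro ω n hn
    have hn' : ⌊t⌋₊ < n := by simpa using hn
    have h1 : (t : ℝ≥0∞) < n := by exact_mod_cast (Nat.floor_lt zero_le).1 hn'
    have h2 := natCast_le_σtime (ε := ε) hq (hc ω) hx hx' n
    have h3 := σtime_le_τtime q ε (fun t => I t ω) x₀ n
    exact ⟨fun h => absurd h.1 (not_le.2 (h1.trans_le h2)),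
      fun h => absurd h.1 (not_le.2 (h1.trans_le (h2.trans h3)))⟩
  have hxm : Measurable fun ω => xPath q ε (fun t => I t ω) x₀ t := by
    have : (fun ω => xPath q ε (fun t => I t ω) x₀ t) = fun ω =>
        ∑ n ∈ Finset.range (⌊t⌋₊ + 1),
        ((Ico (σtime q ε (fun t => I t ω) x₀ n) (τtime q ε (fun t => I t ω) x₀ n)).indicator 1
            (t : ℝ≥0∞) * onPath q ε (fun t => I t ω) (σtime q ε (fun t => I t ω) x₀ n)
              (cycleStart q ε (fun t => I t ω) x₀ n).2 t
          + (Ico (τtime q ε (fun t => I t ω) x₀ n) (σtime q ε (fun t => I t ω) x₀ (n + 1))).indicator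
            1 (t : ℝ≥0∞) * offPath q (τtime q ε (fun t => I t ω) x₀ n) t) := by
      funext ω
      refine tsum_eq_sum fun n hn => ?_
      obtain ⟨h1, h2⟩ := hfin ω n hn
      rw [indicator_of_notMem h1, indicator_of_notMem h2]
      simp
    rw [this]
    refine Finset.measurable_sum _ fun n _ => ?_
    obtain ⟨h1, h2, h3⟩ := measurable_cycleStart (ε := ε) hq hm hc hx hx' n
    exact ((hind n).1.mul (measurable_onPath hm hc h1 h2 t)).add
      ((hind n).2.mul (measurable_offPath h3 measurable_const))
  have hym : Measurable fun ω => yPath q ε (fun t => I t ω) x₀ t := by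
    have : (fun ω => yPath q ε (fun t => I t ω) x₀ t) = fun ω =>
        ∑ n ∈ Finset.range (⌊t⌋₊ + 1), (Ico (σtime q ε (fun t => I t ω) x₀ n)
          (τtime q ε (fun t => I t ω) x₀ n)).indicator 1 (t : ℝ≥0∞) := by
      funext ω
      exact tsum_eq_sum fun n hn => indicator_of_notMem (hfin ω n hn).1 _
    rw [this]
    exact Finset.measurable_sum _ fun n _ => (hind n).1
  refine Measurable.subtype_mk ((WithLp.measurable_toLp 2 _).comp (measurable_pi_lambda _ fun i => ?_))
  fin_cases i
  · exact hxm
  · exact hym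

theorem measurable_skorokhodDist_noisyState (hq : q.Admissible) (hm : ∀ t, Measurable (I t))
    (hc : ∀ ω, Continuous fun t => I t ω) (hx : 0 ≤ x₀) (hx' : x₀ < q.xref) (T : ℕ)
    (z : ℝ≥0 → State) : Measurable fun ω => skorokhodDist T (noisyState q ε I x₀ ω) z :=
  measurable_skorokhodDist (fun t => measurable_statePath hq hm hc hx hx' t)
    (fun ω => hasFineNodes_statePath hq (hc ω) hx hx' T) z

end

/-- Here paths are continuous and coordinates measurable only up to null sets. Setting the path to
zero on the exceptional set and working with the completed σ-algebra reduces this to the everywhere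
version. -/
theorem aemeasurable_skorokhodDist_noisyState {Ω : Type*} [MeasurableSpace Ω] {P : Measure Ω}
    {q : Params} (hq : q.Admissible) {ε x₀ : ℝ} {I : ℝ≥0 → Ω → ℝ}
    (hm : ∀ t, AEMeasurable (I t) P) (hc : ∀ᵐ ω ∂P, Continuous fun t => I t ω)
    (hx : 0 ≤ x₀) (hx' : x₀ < q.xref) (T : ℕ) (z : ℝ≥0 → State) :
    AEMeasurable (fun ω => skorokhodDist T (noisyState q ε I x₀ ω) z) P := by
  classical
  set C : Set Ω := {ω | Continuous fun t => I t ω}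
  have hC : NullMeasurableSet C P := NullMeasurableSet.of_compl (NullMeasurableSet.of_null hc)
  set J : ℝ≥0 → Ω → ℝ := fun t => C.piecewise (I t) 0
  have hJc : ∀ ω, Continuous fun t => J t ω := fun ω => by
    by_cases h : ω ∈ C
    · simpa [J, h] using (show Continuous fun t => I t ω from h)
    · simpa [J, h] using continuous_const
  have hJm : ∀ t, NullMeasurable (J t) P := fun t s hs => by
    have h1 := (hm t).nullMeasurable hs
    have : J t ⁻¹' s = (C ∩ I t ⁻¹' s) ∪ (Cᶜ ∩ (0 : Ω → ℝ) ⁻¹' s) := by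
      ext ω
      by_cases h : ω ∈ C <;> simp [J, h]
    rw [this]
    exact (hC.inter h1).union
      (hC.compl.inter ((measurable_zero hs).nullMeasurableSet))
  have h2 : NullMeasurable (fun ω => skorokhodDist T (noisyState q ε J x₀ ω) z) P :=
    measurable_skorokhodDist_noisyState (Ω := NullMeasurableSpace Ω P) hq hJm hJc hx hx' T z
  refine h2.aemeasurable.congr ?_
  filter_upwards [hc] with ω hω
  have hω' : ω ∈ C := hω
  have : (fun t => J t ω) = fun t => I t ω := by
    funext t
    simp [J, hω']
  simp only [noisyState, this]

/-! ### The return map, its contraction, and stability of the fixed point under noise -/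

/-- The equilibrium of the ON dynamics. -/
noncomputable def Params.equil (q : Params) : ℝ := q.β / q.αon

/-- The distance of the reference level from the equilibrium of the ON dynamics. -/
noncomputable def Params.gap (q : Params) : ℝ := q.equil - q.xref

/-- The value at the end of a clock period, as a function of `gap * exp (αon * θ)`, where `θ` is
the time spent in the ON configuration. -/
noncomputable def Params.returnMap (q : Params) (w : ℝ) : ℝ :=
  q.xref * Real.exp (-q.αoff) * (w / q.gap) ^ (q.αoff / q.αon)

/-- The Lipschitz constant of the return map. -/
noncomputable def Params.rate (q : Params) : ℝ :=
  q.xref * (q.αoff / q.αon) / q.gap * Real.exp (-q.αon)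

section

variable {q : Params}

theorem Params.Admissible.xref_lt_gap (hq : q.Admissible) : q.xref < q.gap := by
  have h := hq.lt_β
  have : 2 * q.xref < q.β / q.αon := by rwa [lt_div_iff₀ hq.αon_pos]
  rw [Params.gap, Params.equil]
  linarith

theorem Params.Admissible.gap_pos (hq : q.Admissible) : 0 < q.gap :=
  hq.xref_pos.trans hq.xref_lt_gap

theorem Params.Admissible.xref_lt_equil (hq : q.Admissible) : q.xref < q.equil := by
  have := hq.gap_pos
  rw [Params.gap] at this
  linarith

theorem Params.Admissible.rate_nonneg (hq : q.Admissible) : 0 ≤ q.rate := by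
  have := hq.gap_pos
  have := hq.xref_pos
  have := hq.αon_pos
  have := hq.αoff_pos
  unfold Params.rate
  positivity

/-- The upper bound on `αoff` says exactly that `xref * (αoff / αon) < gap`; the remaining factor
`exp (-αon)` is at most `1`. -/
theorem Params.Admissible.rate_lt_one (hq : q.Admissible) : q.rate < 1 := by
  have hB := hq.gap_pos
  have hx := hq.xref_pos
  have ha := hq.αon_pos
  have h1 : q.xref * (q.αoff / q.αon) / q.gap < 1 := by
    have h2 : q.αoff < q.gap / q.xref * q.αon := hq.αoff_lt
    rw [div_lt_one hB, ← mul_div_assoc, div_lt_iff₀ ha]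
    calc q.xref * q.αoff < q.xref * (q.gap / q.xref * q.αon) := by gcongr
      _ = q.gap * q.αon := by field_simp
  have h3 : Real.exp (-q.αon) ≤ 1 := Real.exp_le_one_iff.2 (by linarith)
  have h4 : 0 < Real.exp (-q.αon) := Real.exp_pos _
  unfold Params.rate
  nlinarith

theorem Params.Admissible.returnMap_exp (hq : q.Admissible) (θ : ℝ) :
    q.returnMap (q.gap * Real.exp (q.αon * θ)) = q.xref * Real.exp (-q.αoff * (1 - θ)) := by
  have ha := hq.αon_pos
  rw [Params.returnMap, mul_div_cancel_left₀ _ hq.gap_pos.ne', ← Real.exp_mul, mul_assoc,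
    ← Real.exp_add]
  congr 2
  field_simp
  ring

/-- A fixed point in the affine branch would be the equilibrium, which exceeds `xref`, and `xref`
itself is mapped to `xref * exp (-αoff)`. So the fixed point is interior to the power branch, and
the unperturbed passage happens strictly inside each period. -/
theorem Params.Admissible.strobe_fixed (hq : q.Admissible) {x : ℝ} (hx : x ∈ Icc 0 q.xref)
    (hfix : q.strobe x = x) :
    x < q.xref ∧ q.equil - x < q.gap * Real.exp q.αon ∧ q.returnMap (q.equil - x) = x := by
  have hB := hq.gap_pos
  have hb := hq.xref_lt_equil
  unfold Params.strobe at hfix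
  split_ifs at hfix with h
  · have h1 : Real.exp (-q.αon) < 1 := Real.exp_lt_one_iff.2 (by linarith [hq.αon_pos])
    have h2 : (q.equil - x) * (1 - Real.exp (-q.αon)) = 0 := by
      rw [Params.equil]; linarith
    have h3 : 0 < q.equil - x := by linarith [hx.2]
    nlinarith
  · have h3 : q.returnMap (q.equil - x) = x := hfix
    refine ⟨lt_of_le_of_ne hx.2 fun hxx => ?_, ?_, h3⟩
    · rw [hxx, ← Params.gap, Params.returnMap, div_self hB.ne', Real.one_rpow, mul_one] at h3
      have := Real.exp_lt_one_iff.2 (show -q.αoff < 0 by linarith [hq.αoff_pos])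
      nlinarith [hq.xref_pos]
    · rw [Params.xborder] at h
      rw [Params.gap, Params.equil]
      linarith

theorem abs_rpow_sub_rpow_le {κ M : ℝ} (hκ : 1 ≤ κ) {x y : ℝ} (hx : 0 ≤ x) (hy : 0 ≤ y)
    (hxM : x ≤ M) (hyM : y ≤ M) : |x ^ κ - y ^ κ| ≤ κ * M ^ (κ - 1) * |x - y| := by
  have := (convex_Icc (0 : ℝ) M).norm_image_sub_le_of_norm_hasDerivWithin_le
    (f := fun x => x ^ κ) (f' := fun x => κ * x ^ (κ - 1)) (C := κ * M ^ (κ - 1))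
    (fun z _ => (Real.hasDerivAt_rpow_const (Or.inr hκ)).hasDerivWithinAt)
    (fun z hz => by
      have h0 : 0 ≤ z ^ (κ - 1) := Real.rpow_nonneg hz.1 _
      rw [Real.norm_eq_abs, abs_of_nonneg (by positivity)]
      gcongr
      · exact hz.1
      · exact hz.2) ⟨hy, hyM⟩ ⟨hx, hxM⟩
  simpa [Real.norm_eq_abs] using this

/-- The exponent `αoff / αon` is at least `1`, so the derivative of the power is largest at the
right end `w / gap = exp αon`, where `exp (-αoff)` and the power combine to `exp (-αon)`. -/
theorem Params.Admissible.abs_returnMap_sub_le (hq : q.Admissible) {w w' : ℝ} (h0 : 0 ≤ w)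
    (h0' : 0 ≤ w') (h1 : w ≤ q.gap * Real.exp q.αon) (h1' : w' ≤ q.gap * Real.exp q.αon) :
    |q.returnMap w - q.returnMap w'| ≤ q.rate * |w - w'| := by
  have hB := hq.gap_pos
  have hx := hq.xref_pos
  have ha := hq.αon_pos
  have hκ : 1 ≤ q.αoff / q.αon := by rw [one_le_div ha]; exact hq.lt_αoff.le
  have h := abs_rpow_sub_rpow_le (M := Real.exp q.αon) hκ (div_nonneg h0 hB.le)
    (div_nonneg h0' hB.le) (by rwa [div_le_iff₀ hB, mul_comm]) (by rwa [div_le_iff₀ hB, mul_comm])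
  have hc : 0 < q.xref * Real.exp (-q.αoff) := by positivity
  rw [Params.returnMap, Params.returnMap, ← mul_sub, abs_mul, abs_of_pos hc]
  refine (mul_le_mul_of_nonneg_left h hc.le).trans_eq ?_
  rw [← sub_div, abs_div, abs_of_pos hB, ← Real.exp_mul, Params.rate]
  have : Real.exp (-q.αon) = Real.exp (-q.αoff) * Real.exp (q.αon * (q.αoff / q.αon - 1)) := by
    rw [← Real.exp_add]
    congr 1
    field_simp
    ring
  rw [this]
  ring

theorem abs_exp_neg_sub_le {x y : ℝ} (hx : 0 ≤ x) (hy : 0 ≤ y) :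
    |Real.exp (-x) - Real.exp (-y)| ≤ |x - y| := by
  wlog h : x ≤ y generalizing x y
  · rw [abs_sub_comm, abs_sub_comm x]
    exact this hy hx (le_of_not_ge h)
  have h1 : Real.exp (-y) ≤ Real.exp (-x) := Real.exp_le_exp.2 (by linarith)
  have h2 : Real.exp (-x) ≤ 1 := Real.exp_le_one_iff.2 (by linarith)
  have h3 : 1 - (y - x) ≤ Real.exp (-(y - x)) := by linarith [Real.add_one_le_exp (-(y - x))]
  have h4 : Real.exp (-y) = Real.exp (-x) * Real.exp (-(y - x)) := by
    rw [← Real.exp_add]; congr 1; ring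
  have h5 : 0 < Real.exp (-x) := Real.exp_pos _
  rw [abs_of_nonneg (by linarith), abs_of_nonpos (by linarith)]
  nlinarith

theorem abs_sub_le_abs_exp_sub {x y : ℝ} (hx : 0 ≤ x) (hy : 0 ≤ y) :
    |x - y| ≤ |Real.exp x - Real.exp y| := by
  wlog h : x ≤ y generalizing x y
  · rw [abs_sub_comm, abs_sub_comm (Real.exp x)]
    exact this hy hx (le_of_not_ge h)
  have h1 : Real.exp x ≤ Real.exp y := Real.exp_le_exp.2 h
  have h2 : 1 ≤ Real.exp x := Real.one_le_exp hx
  have h3 : 1 + (y - x) ≤ Real.exp (y - x) := by linarith [Real.add_one_le_exp (y - x)]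
  have h4 : Real.exp y = Real.exp x * Real.exp (y - x) := by
    rw [← Real.exp_add]; congr 1; ring
  rw [abs_of_nonpos (by linarith), abs_of_nonpos (by linarith)]
  nlinarith

/-- The path `I`, multiplied by `ε`, moves by at most `S * exp (αon * k)` on the `k`-th clock
period, for each of the first `T` clock periods. -/
def NoiseBound (q : Params) (ε : ℝ) (I : ℝ≥0 → ℝ) (T : ℕ) (S : ℝ) : Prop :=
  ∀ k < T, ∀ t : ℝ≥0, k ≤ t → t ≤ k + 1 → |ε * (I t - I k)| ≤ S * Real.exp (q.αon * k)

variable {ε S : ℝ} {I : ℝ≥0 → ℝ} {T : ℕ}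

theorem noiseBound_zero (q : Params) (T : ℕ) : NoiseBound q 0 0 T 0 := fun k _ t _ _ => by simp

theorem NoiseBound.abs_noise_le (h : NoiseBound q ε I T S) (hq : q.Admissible) (hS : 0 ≤ S)
    {k : ℕ} (hk : k < T) {t : ℝ≥0} (h1 : k ≤ t) (h2 : t ≤ k + 1) :
    |ε * Real.exp (-q.αon * t) * (I t - I k)| ≤ S := by
  have ha := hq.αon_pos
  have h1' : (k : ℝ) ≤ t := by exact_mod_cast h1
  have he : 0 < Real.exp (-q.αon * t) := Real.exp_pos _
  have : ε * Real.exp (-q.αon * t) * (I t - I k) = (ε * (I t - I k)) * Real.exp (-q.αon * t) := by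
    ring
  rw [this, abs_mul, abs_of_pos he]
  calc |ε * (I t - I k)| * Real.exp (-q.αon * t)
      ≤ S * Real.exp (q.αon * k) * Real.exp (-q.αon * t) := by gcongr; exact h k hk t h1 h2
    _ = S * Real.exp (q.αon * (k - t)) := by rw [mul_assoc, ← Real.exp_add]; congr 2; ring
    _ ≤ S * 1 := by gcongr; exact Real.exp_le_one_iff.2 (by nlinarith)
    _ = S := mul_one S

/-- By `hsmall` the path is above `xref` at time `n + 1` despite the noise, so it crosses within the
period. Multiplying the crossing equation by `exp (αon * (τ - n))` isolates the noise as the only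
error in `gap * exp (αon * (τ - n))`. -/
theorem passage_of_noiseBound (hq : q.Admissible) (hI : Continuous I)
    (hb : NoiseBound q ε I T S) (hS : 0 ≤ S) {n : ℕ} (hn : n < T) {v : ℝ} (hv : v < q.xref)
    (hsmall : (q.equil - v) * Real.exp (-q.αon) + S < q.gap) :
    ∃ τ : ℝ≥0, (n : ℝ) < τ ∧ (τ : ℝ) < n + 1 ∧ passageTime q ε I n v = τ ∧
      |q.gap * Real.exp (q.αon * (τ - n)) - (q.equil - v)| ≤ Real.exp q.αon * S ∧
      offCurve q τ (n + 1 : ℕ) = q.returnMap (q.gap * Real.exp (q.αon * (τ - n))) := by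
  have ha := hq.αon_pos
  have hend : q.xref < onCurve q ε I n v ((n : ℝ≥0) + 1) := by
    have h1 := hb.abs_noise_le hq hS hn (t := (n : ℝ≥0) + 1) (by simp) le_rfl
    have h2 := (abs_le.1 h1).1
    have h3 : onCurve q ε I n v ((n : ℝ≥0) + 1) = q.equil - (q.equil - v) * Real.exp (-q.αon) +
        ε * Real.exp (-q.αon * ((n : ℝ≥0) + 1 : ℝ≥0)) * (I ((n : ℝ≥0) + 1) - I n) := by
      rw [onCurve]
      have : -q.αon * ((((n : ℝ≥0) + 1 : ℝ≥0) : ℝ) - ((n : ℝ≥0) : ℝ)) = -q.αon := by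
        push_cast; ring
      rw [this, Params.equil]
      ring
    rw [h3]
    rw [Params.gap] at hsmall
    linarith
  rcases passageTime_cases (ε := ε) (s := (n : ℝ≥0)) hI hv with ⟨-, h⟩ | ⟨τ, hst, hτ, hx, hlt⟩
  · exact absurd (h _ (by simp)) (not_lt.2 hend.le)
  have hτ1 : τ < n + 1 := by
    by_contra! hcon
    rcases hcon.eq_or_lt with h | h
    · rw [← h] at hx; linarith
    · exact absurd (hlt _ (by simp) h) (not_lt.2 hend.le)
  have hn1 : (n : ℝ) < τ := by exact_mod_cast hst
  have hn2 : (τ : ℝ) < n + 1 := by exact_mod_cast hτ1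
  refine ⟨τ, hn1, hn2, by exact_mod_cast hτ, ?_, ?_⟩
  · have hN := hb.abs_noise_le hq hS hn hst.le hτ1.le
    set N := ε * Real.exp (-q.αon * τ) * (I τ - I n)
    have hx' : q.equil - (q.equil - v) * Real.exp (-q.αon * (τ - n)) + N = q.xref := by
      rw [← hx, onCurve, Params.equil]
      simp only [NNReal.coe_natCast, N]
      ring
    have h1 : Real.exp (-q.αon * (τ - n)) * Real.exp (q.αon * (τ - n)) = 1 := by
      rw [← Real.exp_add]; simp
    have h2 : q.gap * Real.exp (q.αon * (τ - n)) - (q.equil - v) =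
        -(Real.exp (q.αon * (τ - n)) * N) := by
      have : q.gap = (q.equil - v) * Real.exp (-q.αon * (τ - n)) - N := by
        rw [Params.gap]; linarith
      rw [this, sub_mul, mul_assoc, h1]
      ring
    rw [h2, abs_neg, abs_mul, abs_of_pos (Real.exp_pos _)]
    gcongr
    nlinarith
  · rw [hq.returnMap_exp, offCurve]
    push_cast
    congr 2
    ring

/-- The amplification factor for the deviations at the switching times. -/
noncomputable def Params.ampl (q : Params) : ℝ := q.rate * Real.exp q.αon / (1 - q.rate)

theorem Params.Admissible.ampl_nonneg (hq : q.Admissible) : 0 ≤ q.ampl :=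
  div_nonneg (mul_nonneg hq.rate_nonneg (Real.exp_pos _).le) (by linarith [hq.rate_lt_one])

/-- This is the stationarity equation of the error recursion: a deviation `ampl * S` at the start of
a period grows by `exp αon * S` during the passage and is then contracted by `rate`. -/
theorem Params.Admissible.rate_mul_ampl (hq : q.Admissible) :
    q.rate * (q.ampl + Real.exp q.αon) = q.ampl := by
  have := hq.rate_lt_one
  have : 1 - q.rate ≠ 0 := by linarith
  rw [Params.ampl]
  field_simp
  ring

variable {x : ℝ}

theorem passage_near_fixed (hq : q.Admissible) (hx : x ∈ Icc 0 q.xref) (hfix : q.strobe x = x)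
    (hI : Continuous I) (hb : NoiseBound q ε I T S) (hS : 0 ≤ S)
    (hsmall : (q.equil - x) * Real.exp (-q.αon) + (q.ampl + 1) * S < q.gap)
    {n : ℕ} (hn : n < T) {v : ℝ} (hv : v < q.xref) (hvx : |v - x| ≤ q.ampl * S) :
    ∃ τ : ℝ≥0, (n : ℝ) < τ ∧ (τ : ℝ) < n + 1 ∧ passageTime q ε I n v = τ ∧
      |q.gap * Real.exp (q.αon * (τ - n)) - (q.equil - x)| ≤ (q.ampl + Real.exp q.αon) * S ∧
      |offCurve q τ (n + 1 : ℕ) - x| ≤ q.ampl * S := by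
  have ha := hq.αon_pos
  have hB := hq.gap_pos
  obtain ⟨hx1, hx2, hx3⟩ := hq.strobe_fixed hx hfix
  have he : Real.exp (-q.αon) ≤ 1 := Real.exp_le_one_iff.2 (by linarith)
  have he0 : 0 < Real.exp (-q.αon) := Real.exp_pos _
  have h1 : (q.equil - v) * Real.exp (-q.αon) + S < q.gap := by
    have h2 := (abs_le.1 hvx).1
    have h3 : (x - v) * Real.exp (-q.αon) ≤ q.ampl * S := by
      have : 0 ≤ q.ampl * S := mul_nonneg hq.ampl_nonneg hS
      nlinarith
    nlinarith
  obtain ⟨τ, h2, h3, h4, h5, h6⟩ := passage_of_noiseBound hq hI hb hS hn hv h1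
  have h7 : |q.gap * Real.exp (q.αon * (τ - n)) - (q.equil - x)| ≤
      (q.ampl + Real.exp q.αon) * S := by
    have : q.gap * Real.exp (q.αon * (τ - n)) - (q.equil - x) =
        (q.gap * Real.exp (q.αon * (τ - n)) - (q.equil - v)) - (v - x) := by ring
    rw [this]
    refine (abs_sub _ _).trans ?_
    linarith
  refine ⟨τ, h2, h3, h4, h7, ?_⟩
  have h8 : |q.returnMap (q.gap * Real.exp (q.αon * (τ - n))) - q.returnMap (q.equil - x)| ≤ _ :=
    hq.abs_returnMap_sub_le (by positivity)
    (by linarith [hq.xref_lt_equil]) (by gcongr; nlinarith) hx2.le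
  rw [hx3, ← h6] at h8
  refine h8.trans ?_
  rw [← hq.rate_mul_ampl, mul_assoc]
  exact mul_le_mul_of_nonneg_left h7 hq.rate_nonneg

/-- The ball of radius `ampl * S` about the fixed point is invariant under one noisy period, so the
bound does not deteriorate with `n`, and each cycle lasts exactly one clock period. -/
theorem cycle_near_fixed (hq : q.Admissible) (hx : x ∈ Icc 0 q.xref) (hfix : q.strobe x = x)
    (hI : Continuous I) (hb : NoiseBound q ε I T S) (hS : 0 ≤ S)
    (hsmall : (q.equil - x) * Real.exp (-q.αon) + (q.ampl + 1) * S < q.gap)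
    {n : ℕ} (hn : n ≤ T) :
    σtime q ε I x n = n ∧ |(cycleStart q ε I x n).2 - x| ≤ q.ampl * S := by
  have hx1 := (hq.strobe_fixed hx hfix).1
  induction n with
  | zero =>
    refine ⟨by simp [σtime_zero], ?_⟩
    have : (cycleStart q ε I x 0).2 = x := rfl
    rw [this, sub_self, abs_zero]
    exact mul_nonneg hq.ampl_nonneg hS
  | succ n ih =>
    obtain ⟨h1, h2⟩ := ih (by omega)
    obtain ⟨τ, h3, h4, h5, -, h7⟩ := passage_near_fixed hq hx hfix hI hb hS hsmall
      (show n < T by omega) (cycleStart_cases hq hI hx.1 hx1 n).2.2 h2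
    have hτ : τtime q ε I x n = τ := by rw [τtime_eq, h1, h5]
    have hfl : ⌊τ⌋₊ = n := by
      rw [Nat.floor_eq_iff zero_le]
      exact ⟨by exact_mod_cast h3.le, by exact_mod_cast h4⟩
    rw [σtime_succ, cycleStart_succ_snd_of_coe hτ, hτ, nextPulse_coe, hfl]
    exact ⟨rfl, h7⟩

/-- The time which the unperturbed system spends in the ON configuration in each period. -/
noncomputable def Params.onTime (q : Params) (x : ℝ) : ℝ :=
  Real.log ((q.equil - x) / q.gap) / q.αon

theorem onTime_spec (hq : q.Admissible) (hx : x ∈ Icc 0 q.xref) (hfix : q.strobe x = x) :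
    0 < q.onTime x ∧ q.onTime x < 1 ∧
      q.gap * Real.exp (q.αon * q.onTime x) = q.equil - x := by
  have ha := hq.αon_pos
  have hB := hq.gap_pos
  obtain ⟨hx1, hx2, -⟩ := hq.strobe_fixed hx hfix
  have h1 : q.gap < q.equil - x := by rw [Params.gap]; linarith
  have h2 : 1 < (q.equil - x) / q.gap := by rwa [one_lt_div hB]
  refine ⟨div_pos (Real.log_pos h2) ha, ?_, ?_⟩
  · rw [Params.onTime, div_lt_one ha, Real.log_lt_iff_lt_exp (by linarith), div_lt_iff₀ hB,
      mul_comm]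
    exact hx2
  · rw [Params.onTime, mul_div_cancel₀ _ ha.ne', Real.exp_log (by linarith),
      mul_div_cancel₀ _ hB.ne']

theorem passage_time_near (hq : q.Admissible) (hx : x ∈ Icc 0 q.xref) (hfix : q.strobe x = x)
    (hI : Continuous I) (hb : NoiseBound q ε I T S) (hS : 0 ≤ S)
    (hsmall : (q.equil - x) * Real.exp (-q.αon) + (q.ampl + 1) * S < q.gap)
    {n : ℕ} (hn : n < T) :
    ∃ θ : ℝ≥0, 0 < θ ∧ θ < 1 ∧ τtime q ε I x n = ((n + θ : ℝ≥0) : ℝ≥0∞) ∧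
      |(θ : ℝ) - q.onTime x| ≤ (q.ampl + Real.exp q.αon) / (q.gap * q.αon) * S := by
  have ha := hq.αon_pos
  have hB := hq.gap_pos
  have hx1 := (hq.strobe_fixed hx hfix).1
  obtain ⟨ho0, -, ho⟩ := onTime_spec hq hx hfix
  obtain ⟨h1, h2⟩ := cycle_near_fixed hq hx hfix hI hb hS hsmall hn.le
  obtain ⟨τ, h3, h4, h5, h6, -⟩ := passage_near_fixed hq hx hfix hI hb hS hsmall
      hn (cycleStart_cases hq hI hx.1 hx1 n).2.2 h2
  have h3' : (n : ℝ≥0) < τ := by exact_mod_cast h3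
  have hθ : ((τ - n : ℝ≥0) : ℝ) = τ - n := by
    rw [NNReal.coe_sub h3'.le]; simp
  refine ⟨τ - n, tsub_pos_of_lt h3', ?_, ?_, ?_⟩
  · rw [← NNReal.coe_lt_coe, hθ]
    push_cast
    linarith
  · rw [τtime_eq, h1, h5, add_tsub_cancel_of_le h3'.le]
  · rw [hθ]
    rw [← ho, ← mul_sub, abs_mul, abs_of_pos hB] at h6
    have h7 : |q.αon * (τ - n) - q.αon * q.onTime x| ≤
      |Real.exp (q.αon * (τ - n)) - Real.exp (q.αon * q.onTime x)| :=
      abs_sub_le_abs_exp_sub (mul_nonneg ha.le (by linarith)) (by positivity)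
    rw [← mul_sub, abs_mul, abs_of_pos ha] at h7
    rw [div_mul_eq_mul_div, le_div_iff₀ (by positivity)]
    nlinarith

end

/-! ### From switching times to the Skorokhod distance, for one path -/

/-- Displacements at two nodes differ by at most `2 * η`, while distinct nodes are at least `g / 2`
apart; hence the Lipschitz constant `4 * η / g`, which does not involve `T`. -/
theorem exists_aligning_timeChange {T : ℕ} {θ : ℕ → ℝ≥0} {θ' η g : ℝ} (hg : 0 < g) (hg0 : g ≤ θ')
    (hg1 : g ≤ 1 - θ') (hη : 0 ≤ η) (hηg : 8 * η ≤ g) (hθ : ∀ n < T, |(θ n : ℝ) - θ'| ≤ η) :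
    ∃ lam ∈ timeChanges T, logSlope T lam ≤ ENNReal.ofReal (8 * η / g) ∧ StrictMono lam ∧
      (∀ n : ℕ, n ≤ T → lam n = n) ∧ (∀ n < T, (lam (n + θ n) : ℝ) = n + θ') ∧
      ∀ t : ℝ≥0, t ≤ T → |(lam t : ℝ) - t| ≤ 4 * η / g := by
  classical
  -- Only the values on the node set `A` matter: zero at integers, and the shift of the fractional
  -- part to `θ'` at switching times.
  set h : ℝ≥0 → ℝ := fun a => if a = ⌊a⌋₊ then 0 else θ' - (a - ⌊a⌋₊)
  have hn : ∀ n : ℕ, h n = 0 := fun n => by simp [h]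
  have hθ0 : ∀ n < T, g / 2 ≤ θ n ∧ (θ n : ℝ) ≤ 1 - g / 2 := fun n hnT => by
    obtain ⟨h1, h2⟩ := abs_le.1 (hθ n hnT)
    exact ⟨by linarith, by linarith⟩
  have hτ : ∀ n < T, h (n + θ n) = θ' - θ n := fun n hnT => by
    obtain ⟨h1, h2⟩ := hθ0 n hnT
    have h3 : ⌊(n : ℝ≥0) + θ n⌋₊ = n := by
      rw [Nat.floor_eq_iff zero_le]
      refine ⟨by simp, ?_⟩
      rw [← NNReal.coe_lt_coe]
      push_cast
      linarith
    have h4 : θ n ≠ 0 := fun h0 => by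
      rw [h0, NNReal.coe_zero] at h1
      linarith
    simp only [h, h3]
    rw [if_neg (by simpa using h4)]
    push_cast
    ring
  set A : Set ℝ≥0 := {a | (∃ n : ℕ, n ≤ T ∧ a = n) ∨ ∃ n < T, a = n + θ n}
  have hK0 : 0 ≤ 4 * η / g := by positivity
  set K : ℝ≥0 := ⟨4 * η / g, hK0⟩
  have hK : (K : ℝ) = 4 * η / g := rfl
  have hKg : (K : ℝ) * (g / 2) = 2 * η := by rw [hK]; field_simp; ring
  have hgap : ∀ m < T, ∀ n : ℕ, g / 2 ≤ |(m : ℝ) + θ m - n| := fun m hm n => by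
    obtain ⟨h1, h2⟩ := hθ0 m hm
    rcases le_or_gt n m with h | h
    · have : (n : ℝ) ≤ m := by exact_mod_cast h
      exact le_trans (by linarith) (le_abs_self _)
    · have : (m : ℝ) + 1 ≤ n := by exact_mod_cast h
      exact le_trans (by linarith) (neg_le_abs _)
  have hgap' : ∀ m < T, ∀ n < T, m < n → g / 2 ≤ |(m : ℝ) + θ m - (n + θ n)| :=
    fun m hm n hnT hmn => by
    obtain ⟨h1, h2⟩ := hθ0 m hm
    obtain ⟨h3, h4⟩ := hθ0 n hnT
    have : (m : ℝ) + 1 ≤ n := by exact_mod_cast hmn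
    exact le_trans (by linarith) (neg_le_abs _)
  have hlip : LipschitzOnWith K h A := by
    refine LipschitzOnWith.of_dist_le_mul fun a ha b hb => ?_
    rw [Real.dist_eq, NNReal.dist_eq]
    have key : ∀ c d : ℝ, g / 2 ≤ d → c ≤ 2 * η → c ≤ K * d := fun c d hd hc =>
      hc.trans (hKg ▸ mul_le_mul_of_nonneg_left hd K.2)
    rcases ha with ⟨m, hm, rfl⟩ | ⟨m, hm, rfl⟩ <;> rcases hb with ⟨n, hnT, rfl⟩ | ⟨n, hnT, rfl⟩
    · rw [hn, hn, sub_self, abs_zero]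
      positivity
    · rw [hn, hτ n hnT, zero_sub, abs_neg, abs_sub_comm, abs_sub_comm (((m : ℝ≥0) : ℝ))]
      exact key _ _ (by exact_mod_cast hgap n hnT m) ((hθ n hnT).trans (by linarith))
    · rw [hn, hτ m hm, sub_zero, abs_sub_comm]
      exact key _ _ (by exact_mod_cast hgap m hm n) ((hθ m hm).trans (by linarith))
    · rw [hτ m hm, hτ n hnT]
      have h2 : |θ' - θ m - (θ' - θ n)| ≤ 2 * η := by
        have h3 := abs_le.1 (hθ n hnT)
        have h4 := abs_le.1 (hθ m hm)
        exact abs_le.2 ⟨by linarith, by linarith⟩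
      push_cast
      rcases lt_trichotomy m n with h1 | rfl | h1
      · exact key _ _ (hgap' m hm n hnT h1) h2
      · simp
      · rw [abs_sub_comm ((m : ℝ) + θ m)]
        exact key _ _ (hgap' n hnT m hm h1) h2
  have hK2 : K ≤ 1 / 2 := by
    rw [← NNReal.coe_le_coe, hK, div_le_iff₀ hg]
    push_cast
    linarith
  obtain ⟨lam, hlam, h1, h2, h3, h4⟩ := exists_timeChange (T := T) hK2 hlip
    (Or.inl ⟨0, Nat.zero_le _, by simp⟩) (Or.inl ⟨T, le_rfl, rfl⟩) (by simpa using hn 0) (hn T)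
  have h5 : ∀ n : ℕ, n ≤ T → lam n = n := fun n hnT => by
    rw [← NNReal.coe_inj, h3 _ (Or.inl ⟨n, hnT, rfl⟩), hn, add_zero]
  refine ⟨lam, hlam, h1.trans_eq ?_, h2, h5, fun n hnT => ?_, fun t ht => ?_⟩
  · have : 8 * η / g = 2 * K := by rw [hK]; ring
    rw [this, ENNReal.ofReal_mul zero_le_two, ENNReal.ofReal_coe_nnreal]
    simp
  · rw [h3 _ (Or.inr ⟨n, hnT, rfl⟩), hτ n hnT]
    push_cast
    ring
  -- Comparing with the fixed integer below `t` costs at most one unit of time, so errors do not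
  -- accumulate along the horizon.
  · have hfl : (⌊t⌋₊ : ℝ≥0) ≤ t := Nat.floor_le zero_le
    have h6 := h4 (⌊t⌋₊ : ℝ≥0) t
    rw [h5 _ (by exact_mod_cast hfl.trans ht), sub_self, sub_zero] at h6
    refine h6.trans ?_
    rw [← hK]
    refine mul_le_of_le_one_right K.2 ?_
    have h7 : t < (⌊t⌋₊ : ℝ≥0) + 1 := Nat.lt_floor_add_one t
    have h7' : (t : ℝ) < ((⌊t⌋₊ : ℝ≥0) : ℝ) + 1 := by exact_mod_cast h7
    have h8' : ((⌊t⌋₊ : ℝ≥0) : ℝ) ≤ t := by exact_mod_cast hfl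
    exact abs_le.2 ⟨by linarith, by linarith⟩

section

variable {q : Params} {ε S x : ℝ} {I : ℝ≥0 → ℝ} {T : ℕ}

theorem lt_τtime (hq : q.Admissible) (hI : Continuous I) (hx : 0 ≤ x) (hx' : x < q.xref)
    {n : ℕ} {s : ℝ≥0} (h : σtime q ε I x n = s) : (s : ℝ≥0∞) < τtime q ε I x n := by
  have hv := (cycleStart_cases (ε := ε) hq hI hx hx' n).2.2
  rw [τtime_eq, h]
  rcases passageTime_cases (ε := ε) (s := s) hI hv with ⟨h1, -⟩ | ⟨t, hst, h1, -⟩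
  · rw [h1]; exact ENNReal.coe_lt_top
  · rw [h1]; exact_mod_cast hst

theorem abs_onCurve_sub_le (hq : q.Admissible) {v v' : ℝ} (hv' : 0 ≤ v') (hv'x : v' ≤ q.equil)
    {n : ℕ} {t t' : ℝ≥0} (hnt : (n : ℝ≥0) ≤ t) (hnt' : (n : ℝ≥0) ≤ t')
    (hN : |ε * Real.exp (-q.αon * t) * (I t - I n)| ≤ S) :
    |onCurve q ε I n v t - onCurve q 0 0 n v' t'| ≤
      |v - v'| + q.equil * q.αon * |(t' : ℝ) - t| + S := by
  have ha := hq.αon_pos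
  have h1 : (0 : ℝ) ≤ t - n := sub_nonneg.2 (by exact_mod_cast hnt)
  have h2 : (0 : ℝ) ≤ t' - n := sub_nonneg.2 (by exact_mod_cast hnt')
  have h3 : onCurve q ε I n v t - onCurve q 0 0 n v' t' =
      (v - v') * Real.exp (-(q.αon * (t - n))) - (q.equil - v') *
        (Real.exp (-(q.αon * (t - n))) - Real.exp (-(q.αon * (t' - n)))) +
        ε * Real.exp (-q.αon * t) * (I t - I n) := by
    simp only [onCurve, Params.equil, NNReal.coe_natCast, neg_mul, zero_mul]
    ring
  rw [h3]
  refine (abs_add_le _ _).trans (add_le_add ((abs_sub _ _).trans (add_le_add ?_ ?_)) hN)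
  · rw [abs_mul, abs_of_pos (Real.exp_pos _)]
    exact mul_le_of_le_one_right (abs_nonneg _) (Real.exp_le_one_iff.2 (by nlinarith))
  · have h4 := abs_exp_neg_sub_le (mul_nonneg ha.le h1) (mul_nonneg ha.le h2)
    have h5 : q.αon * (t - n : ℝ) - q.αon * (t' - n) = -(q.αon * ((t' : ℝ) - t)) := by ring
    rw [h5, abs_neg, abs_mul, abs_of_pos ha] at h4
    rw [abs_mul, abs_of_nonneg (by linarith : 0 ≤ q.equil - v'), mul_assoc]
    have h6 : 0 ≤ q.equil := hv'.trans hv'x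
    exact mul_le_mul (by linarith) h4 (abs_nonneg _) h6

theorem abs_offCurve_sub_le (hq : q.Admissible) {τ τ' t t' : ℝ≥0} (h : τ ≤ t) (h' : τ' ≤ t') :
    |offCurve q τ t - offCurve q τ' t'| ≤
      q.xref * q.αoff * (|(t' : ℝ) - t| + |(τ : ℝ) - τ'|) := by
  have ha := hq.αoff_pos
  have hx := hq.xref_pos
  have h1 : (0 : ℝ) ≤ t - τ := sub_nonneg.2 h
  have h2 : (0 : ℝ) ≤ t' - τ' := sub_nonneg.2 h'
  simp only [offCurve, neg_mul]
  rw [← mul_sub, abs_mul, abs_of_pos hx, mul_assoc]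
  refine mul_le_mul_of_nonneg_left ?_ hx.le
  refine (abs_exp_neg_sub_le (mul_nonneg ha.le h1) (mul_nonneg ha.le h2)).trans ?_
  rw [← mul_sub, abs_mul, abs_of_pos ha]
  refine mul_le_mul_of_nonneg_left ?_ ha.le
  have : (t - τ : ℝ) - (t' - τ') = -((t' : ℝ) - t) - (τ - τ') := by ring
  rw [this]
  exact (abs_sub _ _).trans_eq (by rw [abs_neg])

/-- The Lipschitz constant of the times spent in the ON configuration. -/
noncomputable def Params.timeGain (q : Params) : ℝ :=
  (q.ampl + Real.exp q.αon) / (q.gap * q.αon)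

theorem Params.Admissible.timeGain_nonneg (hq : q.Admissible) : 0 ≤ q.timeGain :=
  div_nonneg (add_nonneg hq.ampl_nonneg (Real.exp_pos _).le)
    (mul_nonneg hq.gap_pos.le hq.αon_pos.le)

theorem skorokhodDist_le_of_small (hq : q.Admissible) (hx : x ∈ Icc 0 q.xref)
    (hfix : q.strobe x = x) (hI : Continuous I) (hb : NoiseBound q ε I T S) (hS : 0 ≤ S)
    (hsmall : (q.equil - x) * Real.exp (-q.αon) + (q.ampl + 1) * S < q.gap) {g : ℝ} (hg : 0 < g)
    (hg0 : g ≤ q.onTime x) (hg1 : g ≤ 1 - q.onTime x) (hSg : 8 * (q.timeGain * S) ≤ g) :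
    skorokhodDist T (statePath q ε I x) (detState q x) ≤
      ENNReal.ofReal ((8 * q.timeGain / g + (q.ampl + q.equil * q.αon * (4 * q.timeGain / g) + 1)
        + q.xref * q.αoff * (4 * q.timeGain / g + q.timeGain)) * S) := by
  have ha := hq.αon_pos
  have hxb := hq.xref_lt_equil
  have hb0 : 0 < q.equil := hq.xref_pos.trans hxb
  have hE := hq.timeGain_nonneg
  have hD := hq.ampl_nonneg
  have hxr := hq.xref_pos
  have hao := hq.αoff_pos
  obtain ⟨hx1, hx2, -⟩ := hq.strobe_fixed hx hfix
  obtain ⟨ho0, ho1, ho⟩ := onTime_spec hq hx hfix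
  have hsmall0 : (q.equil - x) * Real.exp (-q.αon) + (q.ampl + 1) * 0 < q.gap := by
    have : 0 ≤ (q.ampl + 1) * S := by positivity
    linarith
  have hI0 : Continuous (0 : ℝ≥0 → ℝ) := continuous_zero
  -- The unperturbed trajectory is the case `S = 0` of the same estimates, which makes it exactly
  -- periodic.
  have hdσ : ∀ n : ℕ, σtime q 0 0 x n = n ∧ (cycleStart q 0 0 x n).2 = x := fun n => by
    obtain ⟨h1, h2⟩ := cycle_near_fixed hq hx hfix hI0 (noiseBound_zero q n) le_rfl hsmall0 le_rfl
    rw [mul_zero] at h2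
    exact ⟨h1, by linarith [abs_nonpos_iff.1 h2]⟩
  set o : ℝ≥0 := ⟨q.onTime x, ho0.le⟩
  have hoc : (o : ℝ) = q.onTime x := rfl
  have hdτ : ∀ n : ℕ, τtime q 0 0 x n = ((n + o : ℝ≥0) : ℝ≥0∞) := fun n => by
    obtain ⟨θ, -, -, h1, h2⟩ := passage_time_near hq hx hfix hI0 (noiseBound_zero q (n + 1)) le_rfl
      hsmall0 n.lt_succ_self
    rw [mul_zero] at h2
    have : θ = o := by
      rw [← NNReal.coe_inj, hoc]
      linarith [abs_nonpos_iff.1 h2]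
    rw [h1, this]
  have hex : ∀ n : ℕ, ∃ θ : ℝ≥0, n < T → 0 < θ ∧ θ < 1 ∧
      τtime q ε I x n = ((n + θ : ℝ≥0) : ℝ≥0∞) ∧ |(θ : ℝ) - q.onTime x| ≤ q.timeGain * S := fun n => by
    by_cases hn : n < T
    · obtain ⟨θ, h⟩ := passage_time_near hq hx hfix hI hb hS hsmall hn
      exact ⟨θ, fun _ => h⟩
    · exact ⟨0, fun h => absurd h hn⟩
  choose θ hθ using hex
  obtain ⟨lam, hlam, hl1, hl2, hl3, hl4, hl5⟩ := exists_aligning_timeChange (T := T) (θ := θ) hg hg0 hg1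
    (mul_nonneg hE hS) hSg fun n hn => (hθ n hn).2.2.2
  refine skorokhodDist_le hlam (hl1.trans (ENNReal.ofReal_le_ofReal ?_)) fun t ht => ?_
  · rw [add_mul, add_mul, add_assoc, div_mul_eq_mul_div, mul_assoc 8]
    refine le_add_of_nonneg_right ?_
    positivity
  refine edist_statePath_le ?_
  have hlt := hl5 t ht
  have hrw : 4 * (q.timeGain * S) / g = 4 * q.timeGain / g * S := by ring
  rw [hrw] at hlt
  have hdrop : q.ampl * S + q.equil * q.αon * (4 * q.timeGain / g * S) + S ≤
      (8 * q.timeGain / g + (q.ampl + q.equil * q.αon * (4 * q.timeGain / g) + 1)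
        + q.xref * q.αoff * (4 * q.timeGain / g + q.timeGain)) * S := by
    have h1 : 0 ≤ 8 * q.timeGain / g * S := by positivity
    have h2 : 0 ≤ q.xref * q.αoff * (4 * q.timeGain / g + q.timeGain) * S := by positivity
    linarith
  have hdrop' : q.xref * q.αoff * (4 * q.timeGain / g * S + q.timeGain * S) ≤
      (8 * q.timeGain / g + (q.ampl + q.equil * q.αon * (4 * q.timeGain / g) + 1)
        + q.xref * q.αoff * (4 * q.timeGain / g + q.timeGain)) * S := by
    have h1 : 0 ≤ 8 * q.timeGain / g * S := by positivity
    have h2 : 0 ≤ (q.ampl + q.equil * q.αon * (4 * q.timeGain / g) + 1) * S := by positivity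
    linarith
  -- At the final time a new cycle begins, for which no noise bound is available; only the starting
  -- values of the two ON pieces are compared.
  rcases ht.eq_or_lt with rfl | htT
  · obtain ⟨h1, h2⟩ := cycle_near_fixed hq hx hfix hI hb hS hsmall le_rfl
    obtain ⟨h3, h4⟩ := hdσ T
    have h5 := lt_τtime (ε := ε) (s := (T : ℝ≥0)) hq hI hx.1 hx1 (by exact_mod_cast h1)
    have h6 := lt_τtime (ε := 0) (s := (T : ℝ≥0)) hq hI0 hx.1 hx1 (by exact_mod_cast h3)
    have h1' : σtime q ε I x T ≤ ((T : ℝ≥0) : ℝ≥0∞) := by rw [h1]; simp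
    have h3' : σtime q 0 0 x T ≤ ((T : ℝ≥0) : ℝ≥0∞) := by rw [h3]; simp
    have h7 := h5.trans_le (τtime_le_σtime_succ q ε I x T)
    have h8 := h6.trans_le (τtime_le_σtime_succ q 0 0 x T)
    rw [hl3 T le_rfl, xPath_eq h1' h7, xPath_eq h3' h8, yPath_eq h1' h7, yPath_eq h3' h8,
      if_pos h5, if_pos h6, if_pos h5, if_pos h6, h1, h3, h4, sub_self, abs_zero, add_zero]
    have h9 := onPath_coe (q := q) (ε := ε) (I := I) (v := (cycleStart q ε I x T).2)
      (le_refl (T : ℝ≥0))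
    have h10 := onPath_coe (q := q) (ε := 0) (I := 0) (v := x) (le_refl (T : ℝ≥0))
    rw [ENNReal.coe_natCast] at h9 h10
    rw [h9, h10, onCurve_self, onCurve_self]
    refine h2.trans (le_trans ?_ hdrop)
    have : 0 ≤ q.equil * q.αon * (4 * q.timeGain / g * S) := by positivity
    linarith
  · obtain ⟨n, hn⟩ : ∃ n, n = ⌊t⌋₊ := ⟨_, rfl⟩
    have hnt : (n : ℝ≥0) ≤ t := hn ▸ Nat.floor_le zero_le
    have htn : t < (n : ℝ≥0) + 1 := hn ▸ Nat.lt_floor_add_one t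
    have hnT : n < T := by exact_mod_cast hnt.trans_lt htT
    have hnl : (n : ℝ≥0) ≤ lam t := hl3 n hnT.le ▸ hl2.monotone hnt
    have hln : lam t < (n : ℝ≥0) + 1 := by
      have := hl2 htn
      have h2 := hl3 (n + 1) hnT
      push_cast at h2
      rwa [h2] at this
    obtain ⟨h1, h2⟩ := cycle_near_fixed hq hx hfix hI hb hS hsmall hnT.le
    obtain ⟨h3, -⟩ := cycle_near_fixed hq hx hfix hI hb hS hsmall hnT
    obtain ⟨h4, h5⟩ := hdσ n
    obtain ⟨h6, -⟩ := hdσ (n + 1)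
    obtain ⟨hθ0, hθ1, h7, h8⟩ := hθ n hnT
    have h9 := hdτ n
    have hA : σtime q ε I x n ≤ t := by rw [h1]; exact_mod_cast hnt
    have hA' : (t : ℝ≥0∞) < σtime q ε I x (n + 1) := by rw [h3]; exact_mod_cast htn
    have hB : σtime q 0 0 x n ≤ lam t := by rw [h4]; exact_mod_cast hnl
    have hB' : (lam t : ℝ≥0∞) < σtime q 0 0 x (n + 1) := by rw [h6]; exact_mod_cast hln
    have hlo : lam (n + θ n) = n + o := by
      rw [← NNReal.coe_inj, hl4 n hnT]
      simp [hoc]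
    -- The deformation matches the switching times, so the modes agree and the discrete components
    -- cancel.
    have hiff : (t : ℝ≥0∞) < τtime q ε I x n ↔ (lam t : ℝ≥0∞) < τtime q 0 0 x n := by
      rw [h7, h9, ENNReal.coe_lt_coe, ENNReal.coe_lt_coe, ← hlo, hl2.lt_iff_lt]
    rw [xPath_eq hA hA', xPath_eq hB hB', yPath_eq hA hA', yPath_eq hB hB']
    by_cases hτ : (t : ℝ≥0∞) < τtime q ε I x n
    · rw [if_pos hτ, if_pos (hiff.1 hτ), if_pos hτ, if_pos (hiff.1 hτ), sub_self, abs_zero, add_zero,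
        h1, h4, h5]
      have h10 := onPath_coe (q := q) (ε := ε) (I := I) (v := (cycleStart q ε I x n).2) hnt
      have h11 := onPath_coe (q := q) (ε := 0) (I := 0) (v := x) hnl
      rw [ENNReal.coe_natCast] at h10 h11
      rw [h10, h11]
      refine (abs_onCurve_sub_le hq hx.1 (by linarith) hnt hnl
        (hb.abs_noise_le hq hS hnT hnt htn.le)).trans (le_trans ?_ hdrop)
      gcongr
    · have hτ' := hiff.not.1 hτ
      rw [if_neg hτ, if_neg hτ', if_neg hτ, if_neg hτ', sub_self, abs_zero, add_zero]
      rw [h7] at hτ ⊢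
      rw [h9] at hτ' ⊢
      have h10 : (n : ℝ≥0) + θ n ≤ t := by exact_mod_cast not_lt.1 hτ
      have h11 : (n : ℝ≥0) + o ≤ lam t := by exact_mod_cast not_lt.1 hτ'
      rw [offPath_coe h10, offPath_coe h11]
      refine (abs_offCurve_sub_le hq h10 h11).trans (le_trans ?_ hdrop')
      have h12 : ((n + θ n : ℝ≥0) : ℝ) - ((n + o : ℝ≥0) : ℝ) = θ n - q.onTime x := by
        push_cast
        rw [hoc]
        ring
      rw [h12]
      gcongr

/-- The bound for the accumulated noise of a cycle of arbitrary length. -/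
noncomputable def Params.noiseGain (q : Params) : ℝ := 1 / (Real.exp q.αon - 1) + 1

theorem Params.Admissible.noiseGain_pos (hq : q.Admissible) : 0 < q.noiseGain := by
  have : 1 < Real.exp q.αon := Real.one_lt_exp_iff.2 hq.αon_pos
  have : 0 < Real.exp q.αon - 1 := by linarith
  unfold Params.noiseGain
  positivity

/-- For large noise a cycle may span many periods. The contributions `S * exp (αon * j)` form a
geometric sum dominated by its last terms, so the bound is free of the number of periods. -/
theorem NoiseBound.abs_sub_natCast_le (h : NoiseBound q ε I T S) (hq : q.Admissible) (hS : 0 ≤ S)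
    {k m : ℕ} (hkm : k ≤ m) (hm : m ≤ T) :
    |ε * (I m - I k)| ≤ S * (Real.exp (q.αon * m) * (1 / (Real.exp q.αon - 1))) := by
  have h1 : 1 < Real.exp q.αon := Real.one_lt_exp_iff.2 hq.αon_pos
  have h2 : 0 < Real.exp q.αon - 1 := by linarith
  induction m, hkm using Nat.le_induction with
  | base => simp only [sub_self, mul_zero, abs_zero]; positivity
  | succ m hkm ih =>
    have h3 := ih (by omega)
    have h4 := h m (by omega) ((m : ℝ≥0) + 1) (by simp) le_rfl
    push_cast
    have h5 : ε * (I ((m : ℝ≥0) + 1) - I k) = ε * (I ((m : ℝ≥0) + 1) - I m) + ε * (I m - I k) := by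
      ring
    rw [h5]
    refine (abs_add_le _ _).trans ((add_le_add h4 h3).trans_eq ?_)
    rw [mul_add, Real.exp_add, mul_one]
    field_simp
    ring

theorem NoiseBound.abs_long_noise_le (h : NoiseBound q ε I T S) (hq : q.Admissible) (hS : 0 ≤ S)
    {k : ℕ} {t : ℝ≥0} (hkt : k ≤ t) (ht : t ≤ T) :
    |ε * Real.exp (-q.αon * t) * (I t - I k)| ≤ S * q.noiseGain := by
  have h1 : 1 < Real.exp q.αon := Real.one_lt_exp_iff.2 hq.αon_pos
  have h2 : 0 < Real.exp q.αon - 1 := by linarith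
  obtain ⟨m, hm⟩ : ∃ m, m = ⌊t⌋₊ := ⟨_, rfl⟩
  have hmt : (m : ℝ≥0) ≤ t := hm ▸ Nat.floor_le zero_le
  have htm : t < (m : ℝ≥0) + 1 := hm ▸ Nat.lt_floor_add_one t
  have hkm : k ≤ m := hm ▸ Nat.le_floor hkt
  have hmT : m ≤ T := by exact_mod_cast hmt.trans ht
  have h3 := h.abs_sub_natCast_le hq hS hkm hmT
  have h4 : |ε * (I t - I m)| ≤ S * Real.exp (q.αon * m) := by
    rcases hmT.eq_or_lt with h5 | h5
    · have : t = m := le_antisymm (h5 ▸ ht) hmt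
      rw [this, sub_self, mul_zero, abs_zero]
      positivity
    · exact h m h5 t hmt htm.le
  have h5 : |ε * (I t - I k)| ≤ S * Real.exp (q.αon * m) * q.noiseGain := by
    have : ε * (I t - I k) = ε * (I m - I k) + ε * (I t - I m) := by ring
    rw [this]
    refine (abs_add_le _ _).trans ((add_le_add h3 h4).trans_eq ?_)
    rw [Params.noiseGain]
    ring
  have he : 0 < Real.exp (-q.αon * t) := Real.exp_pos _
  have h6 : ε * Real.exp (-q.αon * t) * (I t - I k) = (ε * (I t - I k)) * Real.exp (-q.αon * t) := by
    ring
  rw [h6, abs_mul, abs_of_pos he]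
  have hng := hq.noiseGain_pos
  have hmt' : (m : ℝ) ≤ t := by exact_mod_cast hmt
  calc |ε * (I t - I k)| * Real.exp (-q.αon * t)
      ≤ S * Real.exp (q.αon * m) * q.noiseGain * Real.exp (-q.αon * t) := by gcongr
    _ = S * q.noiseGain * Real.exp (q.αon * (m - t)) := by
        have : Real.exp (q.αon * (m - t)) = Real.exp (q.αon * m) * Real.exp (-q.αon * t) := by
          rw [← Real.exp_add]; congr 1; ring
        rw [this]; ring
    _ ≤ S * q.noiseGain * 1 := by
        gcongr
        exact Real.exp_le_one_iff.2 (by nlinarith [hq.αon_pos])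
    _ = S * q.noiseGain := mul_one _

theorem abs_xPath_le (hq : q.Admissible) (hx : 0 ≤ x) (hx' : x < q.xref) (hI : Continuous I)
    (h : NoiseBound q ε I T S) (hS : 0 ≤ S) {t : ℝ≥0} (ht : t ≤ T) :
    |xPath q ε I x t| ≤ q.equil + S * q.noiseGain := by
  have hb := hq.xref_lt_equil
  have hng := hq.noiseGain_pos
  have hSn : 0 ≤ S * q.noiseGain := by positivity
  obtain ⟨n, -, h1, h2⟩ := exists_cycle (ε := ε) hq hI hx hx' t
  obtain ⟨hσ, hv0, hv1⟩ := cycleStart_cases (ε := ε) hq hI hx hx' n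
  rw [xPath_eq h1 h2]
  split_ifs with h3
  · rcases hσ with hσ | ⟨k, -, hσ⟩
    · simp [hσ] at h1
    · rw [hσ] at h1 ⊢
      have hkt : (k : ℝ≥0) ≤ t := by exact_mod_cast h1
      have h4 := onPath_coe (q := q) (ε := ε) (I := I) (v := (cycleStart q ε I x n).2) hkt
      rw [ENNReal.coe_natCast] at h4
      rw [h4, onCurve]
      refine (abs_add_le _ _).trans (add_le_add ?_ (h.abs_long_noise_le hq hS hkt ht))
      have hkt' : (k : ℝ) ≤ t := by exact_mod_cast hkt
      set E := Real.exp (-q.αon * (t - (k : ℝ≥0)))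
      have hE0 : 0 < E := Real.exp_pos _
      have hE1 : E ≤ 1 := Real.exp_le_one_iff.2 (by
        rw [NNReal.coe_natCast]; nlinarith [hq.αon_pos])
      rw [← Params.equil]
      exact abs_le.2 ⟨by nlinarith, by nlinarith⟩
  · rw [not_lt] at h3
    obtain ⟨τ, hτ⟩ : ∃ τ : ℝ≥0, τtime q ε I x n = τ :=
      ⟨_, (ENNReal.coe_toNNReal (ne_top_of_le_ne_top ENNReal.coe_ne_top h3)).symm⟩
    rw [hτ] at h3 ⊢
    have h4 : τ ≤ t := by exact_mod_cast h3
    rw [offPath_coe h4]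
    obtain ⟨h5, h6, -⟩ := offCurve_mem hq.xref_pos hq.αoff_pos h4
    rw [abs_of_nonneg h5]
    linarith

theorem skorokhodDist_le_crude (hq : q.Admissible) (hx : 0 ≤ x) (hx' : x < q.xref)
    (hI : Continuous I) (h : NoiseBound q ε I T S) (hS : 0 ≤ S) :
    skorokhodDist T (statePath q ε I x) (detState q x) ≤
      ENNReal.ofReal (2 * q.equil + 1 + q.noiseGain * S) := by
  refine skorokhodDist_le (id_mem_timeChanges T).1 (by simp [(id_mem_timeChanges T).2])
    fun t ht => edist_statePath_le ?_
  have h1 := abs_xPath_le hq hx hx' hI h hS ht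
  have h2 := abs_xPath_le hq hx hx' continuous_zero (noiseBound_zero q T) le_rfl ht
  have h3 : |yPath q ε I x t - yPath q 0 0 x (id t)| ≤ 1 := by
    rcases yPath_mem q ε I x t with h4 | h4 <;> rcases yPath_mem q 0 0 x (id t) with h5 | h5 <;>
      rw [h4, h5] <;> norm_num
  have h4 := abs_sub (xPath q ε I x t) (xPath q 0 0 x (id t))
  simp only [id] at h4 ⊢
  simp only [id] at h3
  linarith

/-- Below a threshold `δ` the stability estimate applies; above it the additive constant of the
crude bound is absorbed into a multiple of `S`. -/
theorem exists_skorokhodDist_le (hq : q.Admissible) (hx : x ∈ Icc 0 q.xref)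
    (hfix : q.strobe x = x) : ∃ C : ℝ, 0 ≤ C ∧ ∀ (ε : ℝ) (I : ℝ≥0 → ℝ), Continuous I →
      ∀ (T : ℕ) (S : ℝ), 0 ≤ S → NoiseBound q ε I T S →
        skorokhodDist T (statePath q ε I x) (detState q x) ≤ ENNReal.ofReal (C * S) := by
  obtain ⟨hx1, hx2, -⟩ := hq.strobe_fixed hx hfix
  obtain ⟨ho0, ho1, -⟩ := onTime_spec hq hx hfix
  have hE := hq.timeGain_nonneg
  have hD := hq.ampl_nonneg
  have ha := hq.αon_pos
  have hao := hq.αoff_pos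
  have hxr := hq.xref_pos
  have hb0 : 0 < q.equil := hq.xref_pos.trans hq.xref_lt_equil
  have hng := hq.noiseGain_pos
  obtain ⟨g, hg, hg0, hg1⟩ : ∃ g : ℝ, 0 < g ∧ g ≤ q.onTime x ∧ g ≤ 1 - q.onTime x :=
    ⟨min (q.onTime x) (1 - q.onTime x), lt_min ho0 (by linarith), min_le_left _ _, min_le_right _ _⟩
  have hm : 0 < q.gap - (q.equil - x) * Real.exp (-q.αon) := by
    have h1 : Real.exp q.αon * Real.exp (-q.αon) = 1 := by rw [← Real.exp_add]; simp
    have h2 := mul_lt_mul_of_pos_right hx2 (Real.exp_pos (-q.αon))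
    rw [mul_assoc, h1] at h2
    linarith
  -- The threshold keeps the passage inside the period and the time change admissible.
  obtain ⟨δ, hδ0, hδ1, hδ2⟩ : ∃ δ : ℝ, 0 < δ ∧
      (q.ampl + 1) * δ < q.gap - (q.equil - x) * Real.exp (-q.αon) ∧ 8 * (q.timeGain * δ) ≤ g := by
    set m := q.gap - (q.equil - x) * Real.exp (-q.αon)
    refine ⟨min (m / (2 * (q.ampl + 1))) (g / (8 * (q.timeGain + 1))), by positivity, ?_, ?_⟩
    · have h1 := min_le_left (m / (2 * (q.ampl + 1))) (g / (8 * (q.timeGain + 1)))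
      rw [le_div_iff₀ (by positivity)] at h1
      linarith
    · have h1 := min_le_right (m / (2 * (q.ampl + 1))) (g / (8 * (q.timeGain + 1)))
      have h2 : 0 < min (m / (2 * (q.ampl + 1))) (g / (8 * (q.timeGain + 1))) := by positivity
      rw [le_div_iff₀ (by positivity)] at h1
      linarith
  set C₁ := 8 * q.timeGain / g + (q.ampl + q.equil * q.αon * (4 * q.timeGain / g) + 1)
        + q.xref * q.αoff * (4 * q.timeGain / g + q.timeGain) with hC₁
  set C₂ := (2 * q.equil + 1) / δ + q.noiseGain with hC₂
  have h1 : 0 ≤ C₁ := by positivity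
  have h2 : 0 ≤ C₂ := by positivity
  refine ⟨C₁ + C₂, by positivity, fun ε I hI T S hS hb => ?_⟩
  rcases le_or_gt S δ with h | h
  · refine (skorokhodDist_le_of_small hq hx hfix hI hb hS ?_ hg hg0 hg1 ?_).trans
      (ENNReal.ofReal_le_ofReal ?_)
    · have : (q.ampl + 1) * S ≤ (q.ampl + 1) * δ := by gcongr
      linarith
    · exact le_trans (by gcongr) hδ2
    · rw [← hC₁]
      gcongr
      linarith
  · refine (skorokhodDist_le_crude hq hx.1 hx1 hI hb hS).trans (ENNReal.ofReal_le_ofReal ?_)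
    have h3 : 2 * q.equil + 1 ≤ (2 * q.equil + 1) / δ * S := by
      rw [div_mul_eq_mul_div, le_div_iff₀ hδ0]
      gcongr
    have h4 : 0 ≤ C₁ * S := by positivity
    rw [add_mul, hC₂, add_mul]
    linarith

end

/-! ### A maximal inequality for Brownian motion by dyadic chaining -/

/-- Chaining: an odd dyadic point of level `n + 1` is one increment away from its left neighbour,
which already has level `n`. -/
theorem abs_sub_le_of_dyadic {f : ℝ≥0 → ℝ} {c ρ : ℝ} (hc : 0 ≤ c) (hρ : 0 ≤ ρ)
    (h : ∀ n : ℕ, ∀ j < 2 ^ n, |f ((j + 1 : ℕ) / 2 ^ n) - f (j / 2 ^ n)| ≤ c * ρ ^ n) (n : ℕ) :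
    ∀ j : ℕ, j ≤ 2 ^ n → |f (j / 2 ^ n) - f 0| ≤ c * ∑ i ∈ Finset.range (n + 1), ρ ^ i := by
  induction n with
  | zero =>
    intro j hj
    have := h 0 0 (by simp)
    interval_cases j
    · simp [hc]
    · simpa using this
  | succ n ih =>
    have heven : ∀ i : ℕ, i ≤ 2 ^ n → |f ((2 * i : ℕ) / 2 ^ (n + 1)) - f 0| ≤
        c * ∑ i ∈ Finset.range (n + 1), ρ ^ i := fun i hi => by
      have : ((2 * i : ℕ) : ℝ≥0) / 2 ^ (n + 1) = i / 2 ^ n := by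
        push_cast
        rw [pow_succ', mul_div_mul_left _ _ two_ne_zero]
      rw [this]
      exact ih i hi
    intro j hj
    rw [Finset.sum_range_succ, mul_add]
    rcases Nat.even_or_odd' j with ⟨i, rfl | rfl⟩
    · refine (heven i (by rw [pow_succ] at hj; omega)).trans ?_
      have : 0 ≤ c * ρ ^ (n + 1) := by positivity
      linarith
    · have h1 := heven i (by rw [pow_succ] at hj; omega)
      have h2 := h (n + 1) (2 * i) (by omega)
      have h3 := abs_add_le (f ((2 * i + 1 : ℕ) / 2 ^ (n + 1)) - f ((2 * i : ℕ) / 2 ^ (n + 1)))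
        (f ((2 * i : ℕ) / 2 ^ (n + 1)) - f 0)
      rw [sub_add_sub_cancel] at h3
      linarith

theorem tendsto_floor_mul_div {x : ℕ → ℝ≥0} (hx : Tendsto x atTop atTop) (t : ℝ≥0) :
    Tendsto (fun n => (⌊x n * t⌋₊ : ℝ≥0) / x n) atTop (𝓝 t) := by
  have h1 := tendsto_nat_floor_mul_div_atTop (R := ℝ) (a := t) t.2
  rw [← NNReal.tendsto_coe]
  refine (h1.comp (NNReal.tendsto_coe_atTop.2 hx)).congr fun n => ?_
  have h2 : ⌊(t : ℝ) * x n⌋₊ = ⌊x n * t⌋₊ := by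
    rw [mul_comm]
    exact Nonneg.nat_floor_coe (x n * t)
  simp only [Function.comp_apply, h2]
  push_cast
  rfl

theorem abs_sub_le_of_dyadic_of_continuous {f : ℝ≥0 → ℝ} (hf : Continuous f) {c ρ : ℝ}
    (hc : 0 ≤ c) (hρ : 0 ≤ ρ) (hρ1 : ρ < 1)
    (h : ∀ n : ℕ, ∀ j < 2 ^ n, |f ((j + 1 : ℕ) / 2 ^ n) - f (j / 2 ^ n)| ≤ c * ρ ^ n) {t : ℝ≥0}
    (ht : t ≤ 1) : |f t - f 0| ≤ c * (1 - ρ)⁻¹ := by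
  have hlim : Tendsto (fun n : ℕ => (⌊(2 : ℝ≥0) ^ n * t⌋₊ : ℝ≥0) / 2 ^ n) atTop (𝓝 t) := by
    exact tendsto_floor_mul_div (tendsto_pow_atTop_atTop_of_one_lt one_lt_two) t
  refine le_of_tendsto (((hf.tendsto t).comp hlim).sub_const (f 0)).abs
    (Eventually.of_forall fun n => ?_)
  refine (abs_sub_le_of_dyadic hc hρ h n _ ?_).trans ?_
  · refine Nat.floor_le_of_le ?_
    push_cast
    exact mul_le_of_le_one_right (zero_le) ht
  · gcongr
    rw [← tsum_geometric_of_lt_one hρ hρ1]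
    exact (summable_geometric_of_lt_one hρ hρ1).sum_le_tsum _ fun i _ => by positivity

section

variable {Ω : Type*} [MeasurableSpace Ω] {P : Measure Ω}

/-- A weighted sum of the `r`-th powers of the dyadic increments on `[0, 1]`. -/
noncomputable def dyadicEnergy (r : ℕ) (f : ℝ≥0 → ℝ) : ℝ≥0∞ :=
  ∑' n : ℕ, 2 ^ n * ∑ j ∈ Finset.range (2 ^ n), ‖f ((j + 1 : ℕ) / 2 ^ n) - f (j / 2 ^ n)‖ₑ ^ r

/-- The constant of the chaining bound. -/
noncomputable def chainConst (r : ℕ) : ℝ := (1 - (1 / 2 : ℝ) ^ (1 / (r : ℝ)))⁻¹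

theorem chainConst_pos {r : ℕ} (hr : r ≠ 0) : 0 < chainConst r := by
  have : (1 / 2 : ℝ) ^ (1 / (r : ℝ)) < 1 :=
    Real.rpow_lt_one (by norm_num) (by norm_num) (by positivity)
  exact inv_pos.2 (by linarith)

/-- Each single term is bounded by the whole energy. The weight `2 ^ n` thus forces increments of
level `n` to be at most `E * (2 ^ (-1 / r)) ^ n`, and this geometric decay feeds the chaining. -/
theorem abs_sub_le_dyadicEnergy {r : ℕ} (hr : r ≠ 0) {f : ℝ≥0 → ℝ} (hf : Continuous f) {E : ℝ}
    (hE : 0 ≤ E) (h : dyadicEnergy r f ≤ ENNReal.ofReal (E ^ r)) {t : ℝ≥0} (ht : t ≤ 1) :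
    |f t - f 0| ≤ E * chainConst r := by
  have hρ1 : (1 / 2 : ℝ) ^ (1 / (r : ℝ)) < 1 :=
    Real.rpow_lt_one (by norm_num) (by norm_num) (by positivity)
  have hρ0 : (0 : ℝ) ≤ (1 / 2 : ℝ) ^ (1 / (r : ℝ)) := by positivity
  refine abs_sub_le_of_dyadic_of_continuous hf hE hρ0 hρ1 (fun n j hj => ?_) ht
  have h1 : (2 : ℝ≥0∞) ^ n * ‖f ((j + 1 : ℕ) / 2 ^ n) - f (j / 2 ^ n)‖ₑ ^ r ≤
      ENNReal.ofReal (E ^ r) := by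
    refine le_trans ?_ ((ENNReal.le_tsum n).trans h)
    gcongr
    exact Finset.single_le_sum (f := fun j : ℕ => ‖f ((j + 1 : ℕ) / 2 ^ n) - f (j / 2 ^ n)‖ₑ ^ r)
      (fun _ _ => zero_le) (Finset.mem_range.2 hj)
  rw [Real.enorm_eq_ofReal_abs, ← ENNReal.ofReal_pow (abs_nonneg _),
    show (2 : ℝ≥0∞) = ENNReal.ofReal 2 by simp, ← ENNReal.ofReal_pow zero_le_two,
    ← ENNReal.ofReal_mul (by positivity), ENNReal.ofReal_le_ofReal_iff (by positivity)] at h1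
  refine le_of_pow_le_pow_left₀ hr (by positivity) ?_
  have h2 : ((1 / 2 : ℝ) ^ (1 / (r : ℝ))) ^ r = 1 / 2 := by
    rw [one_div (r : ℝ), Real.rpow_inv_natCast_pow (by norm_num) hr]
  rw [mul_pow, ← pow_mul, mul_comm n, pow_mul, h2, one_div, inv_pow, ← div_eq_mul_inv,
    le_div_iff₀ (by positivity), mul_comm]
  exact h1

theorem lintegral_enorm_pow_gaussianReal (m : ℕ) (v : ℝ≥0) :
    ∫⁻ x, ‖x‖ₑ ^ (2 * m) ∂(gaussianReal 0 v) =
      v ^ m * ∫⁻ x, ‖x‖ₑ ^ (2 * m) ∂(gaussianReal 0 1) := by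
  have h1 := gaussianReal_map_const_mul (μ := 0) (v := 1) (Real.sqrt v)
  have h2 : (NNReal.mk (Real.sqrt v ^ 2) (sq_nonneg _)) * 1 = v := by
    rw [mul_one, ← NNReal.coe_inj]
    exact Real.sq_sqrt v.2
  rw [mul_zero, h2] at h1
  rw [← h1, lintegral_map (by fun_prop) (by fun_prop), ← lintegral_const_mul _ (by fun_prop)]
  refine lintegral_congr fun x => ?_
  rw [enorm_mul, mul_pow, pow_mul]
  congr 2
  rw [Real.enorm_eq_ofReal_abs, abs_of_nonneg (Real.sqrt_nonneg _),
    ← ENNReal.ofReal_pow (Real.sqrt_nonneg _), Real.sq_sqrt v.coe_nonneg, ENNReal.ofReal_coe_nnreal]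

theorem lintegral_enorm_pow_gaussianReal_lt_top (r : ℕ) (hr : r ≠ 0) :
    ∫⁻ x, ‖x‖ₑ ^ r ∂(gaussianReal 0 1) < ∞ := by
  have h := (memLp_id_gaussianReal' (μ := 0) (v := 1) (r : ℝ≥0∞) (by simp)).2
  rw [eLpNorm_lt_top_iff_lintegral_rpow_enorm_lt_top (by simpa using hr) (by simp)] at h
  simpa using h

theorem aemeasurable_dyadicEnergy {B : ℝ≥0 → Ω → ℝ} (hB : ∀ t, AEMeasurable (B t) P) (r : ℕ) :
    AEMeasurable (fun ω => dyadicEnergy r fun t => B t ω) P := by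
  unfold dyadicEnergy
  refine AEMeasurable.tsum fun n => AEMeasurable.const_mul ?_ _
  refine Finset.aemeasurable_fun_sum _ fun j _ => ?_
  exact (((hB _).sub (hB _)).enorm).pow_const _

/-- An increment of level `n` has `2m`-th moment `2 ^ (-n * m)` times a constant. With `m ≥ 3` this
beats both the weight `2 ^ n` and the `2 ^ n` increments, leaving a summable `2 ^ (-n)`. -/
theorem lintegral_dyadicEnergy_le {B : ℝ≥0 → Ω → ℝ} (hB : IsPreBrownianReal B P) {m : ℕ}
    (hm : 3 ≤ m) : ∫⁻ ω, dyadicEnergy (2 * m) (fun t => B t ω) ∂P ≤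
      2 * ∫⁻ x, ‖x‖ₑ ^ (2 * m) ∂(gaussianReal 0 1) := by
  set c := ∫⁻ x, ‖x‖ₑ ^ (2 * m) ∂(gaussianReal 0 1) with hc
  have hmeas : ∀ n j : ℕ, AEMeasurable
      (fun ω => ‖B ((j + 1 : ℕ) / 2 ^ n) ω - B (j / 2 ^ n) ω‖ₑ ^ (2 * m)) P := fun n j =>
    (((hB.aemeasurable _).sub (hB.aemeasurable _)).enorm).pow_const _
  have hone : ∀ n j : ℕ, ∫⁻ ω, ‖B ((j + 1 : ℕ) / 2 ^ n) ω - B (j / 2 ^ n) ω‖ₑ ^ (2 * m) ∂P ≤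
      (2⁻¹ ^ n) ^ 3 * c := fun n j => by
    have h1 := (hB.hasLaw_sub ((j + 1 : ℕ) / 2 ^ n) (j / 2 ^ n)).lintegral_comp
      (f := fun x => ‖x‖ₑ ^ (2 * m)) (by fun_prop)
    have hv : nndist ((((j + 1 : ℕ) / 2 ^ n : ℝ≥0)) : ℝ) (((j : ℝ≥0) / 2 ^ n : ℝ≥0) : ℝ) = 2⁻¹ ^ n := by
      rw [← NNReal.coe_inj, coe_nndist, Real.dist_eq]
      push_cast
      rw [← sub_div, add_sub_cancel_left, abs_of_pos (by positivity), one_div, inv_pow]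
    have h3 : ∫⁻ ω, ‖B ((j + 1 : ℕ) / 2 ^ n) ω - B (j / 2 ^ n) ω‖ₑ ^ (2 * m) ∂P =
        ∫⁻ x, ‖x‖ₑ ^ (2 * m) ∂(gaussianReal 0 (2⁻¹ ^ n)) := by
      rw [← hv]; exact h1
    rw [h3, lintegral_enorm_pow_gaussianReal]
    push_cast
    have h4 : ((2 : ℝ≥0∞)⁻¹) ^ n ≤ 1 := pow_le_one₀ zero_le (by simp)
    exact mul_le_mul' (pow_le_pow_of_le_one zero_le h4 hm) le_rfl
  have hterm : ∀ n : ℕ, ∫⁻ ω, 2 ^ n * ∑ j ∈ Finset.range (2 ^ n),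
      ‖B ((j + 1 : ℕ) / 2 ^ n) ω - B (j / 2 ^ n) ω‖ₑ ^ (2 * m) ∂P ≤ 2⁻¹ ^ n * c := fun n => by
    rw [lintegral_const_mul' _ _ (by simp), lintegral_finsetSum' _ fun j _ => hmeas n j]
    calc (2 : ℝ≥0∞) ^ n * ∑ j ∈ Finset.range (2 ^ n),
          ∫⁻ ω, ‖B ((j + 1 : ℕ) / 2 ^ n) ω - B (j / 2 ^ n) ω‖ₑ ^ (2 * m) ∂P
        ≤ 2 ^ n * ∑ j ∈ Finset.range (2 ^ n), (2⁻¹ ^ n) ^ 3 * c := by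
          gcongr with j _
          exact hone n j
      _ = (2 * 2⁻¹) ^ n * (2 * 2⁻¹) ^ n * (2⁻¹ ^ n * c) := by
          rw [Finset.sum_const, Finset.card_range, nsmul_eq_mul, mul_pow]
          push_cast
          ring
      _ = 2⁻¹ ^ n * c := by
          rw [ENNReal.mul_inv_cancel two_ne_zero (by simp)]
          simp
  unfold dyadicEnergy
  rw [lintegral_tsum fun n => (Finset.aemeasurable_fun_sum _ fun j _ => hmeas n j).const_mul _]
  calc _ ≤ ∑' n : ℕ, 2⁻¹ ^ n * c := ENNReal.tsum_le_tsum hterm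
    _ = 2 * c := by
      rw [ENNReal.tsum_mul_right, ENNReal.tsum_geometric, ENNReal.one_sub_inv_two, inv_inv]

/-! ### Increments of the Wiener integral -/

/-- Abel summation moves the differences onto `f`, whose total variation is `f b - f a` by
monotonicity. -/
theorem abs_sum_mul_sub_le {f w : ℕ → ℝ} (hf : Monotone f) {a b : ℕ} (hab : a ≤ b) {M : ℝ}
    (hM : ∀ i, a ≤ i → i ≤ b → |w i - w a| ≤ M) :
    |∑ i ∈ Finset.Ico a b, f i * (w (i + 1) - w i) - f b * (w b - w a)| ≤ M * (f b - f a) := by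
  induction b, hab using Nat.le_induction with
  | base => simp
  | succ b hab ih =>
    have h1 := ih fun i hi hib => hM i hi (by omega)
    have h2 := hM (b + 1) (by omega) le_rfl
    have h3 : 0 ≤ f (b + 1) - f b := sub_nonneg.2 (hf b.le_succ)
    rw [Finset.sum_Ico_succ_top hab]
    have h4 : ∑ i ∈ Finset.Ico a b, f i * (w (i + 1) - w i) + f b * (w (b + 1) - w b) -
        f (b + 1) * (w (b + 1) - w a) = (∑ i ∈ Finset.Ico a b, f i * (w (i + 1) - w i) -
          f b * (w b - w a)) - (f (b + 1) - f b) * (w (b + 1) - w a) := by ring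
    rw [h4]
    refine (abs_sub _ _).trans ?_
    rw [abs_mul, abs_of_nonneg h3]
    nlinarith

/-- The Riemann–Stieltjes sums with equidistant nodes. -/
noncomputable def stieltjesSum (f w : ℝ≥0 → ℝ) (t : ℝ≥0) (n : ℕ) : ℝ :=
  ∑ k ∈ Finset.range n, f (t * k / n) * (w (t * (k + 1) / n) - w (t * k / n))

/-- With `a * N` and `b * N` nodes both partitions have mesh `1 / (d * N)`, so one sum is an initial
segment of the other and the difference lives on `[a / d, b / d]`. -/
theorem abs_stieltjesSum_sub_le {f w : ℝ≥0 → ℝ} (hf : Monotone f) (hf0 : 0 ≤ f) {a b d : ℕ}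
    (hab : a ≤ b) (hd : 0 < d) {M : ℝ}
    (hM : ∀ s : ℝ≥0, (a : ℝ≥0) / d ≤ s → s ≤ (b : ℝ≥0) / d → |w s - w ((a : ℝ≥0) / d)| ≤ M)
    {N : ℕ} (hN : 0 < N) :
    |stieltjesSum f w ((b : ℝ≥0) / d) (b * N) - stieltjesSum f w ((a : ℝ≥0) / d) (a * N)| ≤
      2 * f ((b : ℝ≥0) / d) * M := by
  set u : ℕ → ℝ≥0 := fun i => (i : ℝ≥0) / (d * N)
  have hd' : (0 : ℝ≥0) < d := by exact_mod_cast hd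
  have hN' : (0 : ℝ≥0) < N := by exact_mod_cast hN
  have hu : Monotone u := fun i j hij => by
    have : (i : ℝ≥0) ≤ j := by exact_mod_cast hij
    simp only [u]
    gcongr
  have huN : ∀ i : ℕ, u (i * N) = (i : ℝ≥0) / d := fun i => by
    simp only [u]
    push_cast
    exact mul_div_mul_right _ _ hN'.ne'
  have hsum : ∀ c : ℕ, stieltjesSum f w ((c : ℝ≥0) / d) (c * N) =
      ∑ i ∈ Finset.range (c * N), f (u i) * (w (u (i + 1)) - w (u i)) := fun c => by
    refine Finset.sum_congr rfl fun i hi => ?_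
    have hc : (0 : ℝ≥0) < c := by
      rcases Nat.eq_zero_or_pos c with rfl | h
      · simp at hi
      · exact_mod_cast h
    have hpt : ∀ y : ℝ≥0, (c : ℝ≥0) / d * y / ((c * N : ℕ) : ℝ≥0) = y / (d * N) := fun y => by
      push_cast
      field_simp
    rw [hpt, hpt]
    simp only [u]
    push_cast
    rfl
  have haN : a * N ≤ b * N := Nat.mul_le_mul_right N hab
  rw [hsum, hsum, ← Finset.sum_Ico_eq_sub _ haN]
  have hbound : ∀ i, a * N ≤ i → i ≤ b * N → |w (u i) - w (u (a * N))| ≤ M := fun i h1 h2 => by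
    have h3 := hu h1
    have h4 := hu h2
    rw [huN] at h3 h4 ⊢
    exact hM _ h3 h4
  have h1 := abs_sum_mul_sub_le (f := fun i => f (u i)) (w := fun i => w (u i)) (hf.comp hu) haN hbound
  have h2 := hbound (b * N) haN le_rfl
  have hM0 : 0 ≤ M := (abs_nonneg _).trans h2
  have h3 : |f (u (b * N)) * (w (u (b * N)) - w (u (a * N)))| ≤ f (u (b * N)) * M := by
    rw [abs_mul, abs_of_nonneg (hf0 _)]
    exact mul_le_mul_of_nonneg_left h2 (hf0 _)
  have h4 := abs_add_le (∑ i ∈ Finset.Ico (a * N) (b * N), f (u i) * (w (u (i + 1)) - w (u i)) -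
    f (u (b * N)) * (w (u (b * N)) - w (u (a * N)))) (f (u (b * N)) * (w (u (b * N)) - w (u (a * N))))
  rw [sub_add_cancel] at h4
  have h5 : 0 ≤ M * f (u (a * N)) := mul_nonneg hM0 (hf0 _)
  rw [← huN b]
  linarith

theorem IsWienerIntegral.tendsto_mul {f : ℝ≥0 → ℝ} {W I : ℝ≥0 → Ω → ℝ}
    (hI : IsWienerIntegral P f W I) (a d : ℕ) :
    Tendsto (fun N : ℕ => eLpNorm (fun ω => stieltjesSum f (fun t => W t ω) ((a : ℝ≥0) / d)
      (a * N) - I ((a : ℝ≥0) / d) ω) 2 P) atTop (𝓝 0) := by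
  have h := hI.tendsto ((a : ℝ≥0) / d)
  rcases Nat.eq_zero_or_pos a with rfl | ha
  · refine h.congr fun n => ?_
    simp [stieltjesSum]
  · have h2 : Tendsto (fun N : ℕ => a * N) atTop atTop := tendsto_id.const_mul_atTop' ha
    exact h.comp h2

/-- The bound on the sums survives almost sure convergence along a subsequence of the `L²` limit.
The quantifier over `M` stands inside the almost sure statement because `M` will be a random
oscillation of `W`. -/
theorem IsWienerIntegral.ae_abs_sub_le_of_rat {f : ℝ≥0 → ℝ} {W I : ℝ≥0 → Ω → ℝ}
    (hI : IsWienerIntegral P f W I) (hW : ∀ t, AEMeasurable (W t) P) (hf : Monotone f) (hf0 : 0 ≤ f)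
    {a b d : ℕ} (hab : a ≤ b) (hd : 0 < d) : ∀ᵐ ω ∂P, ∀ M : ℝ,
      (∀ s : ℝ≥0, (a : ℝ≥0) / d ≤ s → s ≤ (b : ℝ≥0) / d → |W s ω - W ((a : ℝ≥0) / d) ω| ≤ M) →
      |I ((b : ℝ≥0) / d) ω - I ((a : ℝ≥0) / d) ω| ≤ 2 * f ((b : ℝ≥0) / d) * M := by
  set R : ℕ → ℕ → Ω → ℝ := fun c N ω => stieltjesSum f (fun t => W t ω) ((c : ℝ≥0) / d) (c * N)
  have hR : ∀ c N, AEStronglyMeasurable (R c N) P := fun c N => by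
    refine AEMeasurable.aestronglyMeasurable ?_
    exact Finset.aemeasurable_fun_sum _ fun k _ => ((hW _).sub (hW _)).const_mul _
  have hIm : ∀ t, AEStronglyMeasurable (I t) P := fun t => (hI.memLp t).1
  have hlim : Tendsto (fun N => eLpNorm ((R b N - R a N) - (I ((b : ℝ≥0) / d) - I ((a : ℝ≥0) / d)))
      2 P) atTop (𝓝 0) := by
    have h := (hI.tendsto_mul b d).add (hI.tendsto_mul a d)
    rw [add_zero] at h
    refine tendsto_of_tendsto_of_tendsto_of_le_of_le tendsto_const_nhds h (fun _ => zero_le)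
      fun N => ?_
    have h1 : (R b N - R a N) - (I ((b : ℝ≥0) / d) - I ((a : ℝ≥0) / d)) =
        (R b N - I ((b : ℝ≥0) / d)) - (R a N - I ((a : ℝ≥0) / d)) := by ring
    simp only
    rw [h1]
    exact eLpNorm_sub_le ((hR b N).sub (hIm _)) ((hR a N).sub (hIm _)) (by norm_num)
  obtain ⟨ns, hns, hae⟩ := (tendstoInMeasure_of_tendsto_eLpNorm two_ne_zero
    (fun N => (hR b N).sub (hR a N)) ((hIm _).sub (hIm _)) hlim).exists_seq_tendsto_ae
  filter_upwards [hae] with ω hω M hM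
  refine le_of_tendsto hω.abs ?_
  filter_upwards [hns.tendsto_atTop.eventually_gt_atTop 0] with i hi
  exact abs_stieltjesSum_sub_le hf hf0 hab hd hM hi

theorem IsWienerIntegral.ae_abs_sub_le {f : ℝ≥0 → ℝ} {W I : ℝ≥0 → Ω → ℝ}
    (hI : IsWienerIntegral P f W I) (hW : ∀ t, AEMeasurable (W t) P) (hf : Monotone f)
    (hf0 : 0 ≤ f) : ∀ᵐ ω ∂P, ∀ (k : ℕ) (t : ℝ≥0), k ≤ t → ∀ M : ℝ,
      (∀ s : ℝ≥0, k ≤ s → s ≤ t → |W s ω - W k ω| ≤ M) → |I t ω - I k ω| ≤ 2 * f t * M := by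
  -- Countably many rational end points share one null set; continuity of `I` then covers every `t`.
  have hall : ∀ᵐ ω ∂P, ∀ k b e : ℕ, k * (e + 1) ≤ b → ∀ M : ℝ,
      (∀ s : ℝ≥0, (k : ℝ≥0) ≤ s → s ≤ (b : ℝ≥0) / (e + 1) → |W s ω - W k ω| ≤ M) →
      |I ((b : ℝ≥0) / (e + 1)) ω - I k ω| ≤ 2 * f ((b : ℝ≥0) / (e + 1)) * M := by
    refine ae_all_iff.2 fun k => ae_all_iff.2 fun b => ae_all_iff.2 fun e => ?_
    by_cases h : k * (e + 1) ≤ b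
    · have h1 := hI.ae_abs_sub_le_of_rat hW hf hf0 h e.succ_pos
      have hk : ((k * (e + 1) : ℕ) : ℝ≥0) / ((e + 1 : ℕ) : ℝ≥0) = k := by
        push_cast
        rw [mul_div_cancel_right₀]
        positivity
      rw [Nat.succ_eq_add_one, hk] at h1
      filter_upwards [h1] with ω hω _
      push_cast at hω
      exact hω
    · exact Eventually.of_forall fun ω h' => absurd h' h
  filter_upwards [hall, hI.cont] with ω hω hc k t hkt M hM
  have hM0 : 0 ≤ M := (abs_nonneg _).trans (hM t hkt le_rfl)
  have hlim : Tendsto (fun e : ℕ => (⌊((e : ℝ≥0) + 1) * t⌋₊ : ℝ≥0) / (e + 1)) atTop (𝓝 t) := by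
    exact tendsto_floor_mul_div 
      (tendsto_atTop_mono (fun n : ℕ => (le_self_add : (n : ℝ≥0) ≤ n + 1))
        tendsto_natCast_atTop_atTop) t
  refine le_of_tendsto (((hc.tendsto t).comp hlim).sub_const (I k ω)).abs
    (Eventually.of_forall fun e => ?_)
  have he : (0 : ℝ≥0) < (e : ℝ≥0) + 1 := by positivity
  have hle : (⌊((e : ℝ≥0) + 1) * t⌋₊ : ℝ≥0) / (e + 1) ≤ t := by
    rw [div_le_iff₀ he, mul_comm t]
    exact Nat.floor_le zero_le
  refine (hω k _ e (Nat.le_floor ?_) M fun s h1 h2 => hM s h1 (h2.trans hle)).trans ?_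
  · push_cast
    rw [mul_comm]
    gcongr
  · have := hf hle
    gcongr

end

/-! ### Moment bounds and conclusion -/

section

variable {Ω : Type*} [MeasurableSpace Ω] {P : Measure Ω} {q : Params} {W I : ℝ≥0 → Ω → ℝ} {x : ℝ}

/-- The worst period is bounded by the sum over all periods: the `r`-th root `E` of the total energy
controls the oscillation of `W` on each of them, and the pathwise estimate is applied with `S` a
multiple of `ε * E`. -/
theorem exists_ae_skorokhodDist_pow_le (hq : q.Admissible) (hW : IsBrownianReal W P)
    (hI : IsWienerIntegral P (fun u : ℝ≥0 => Real.exp (q.αon * u)) W I) (hx : x ∈ Icc 0 q.xref)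
    (hfix : q.strobe x = x) {r : ℕ} (hr : r ≠ 0) : ∃ A : ℝ, 0 < A ∧ ∀ ε : ℝ, 0 < ε → ∀ T : ℕ,
      ∀ᵐ ω ∂P, skorokhodDist T (noisyState q ε I x ω) (detState q x) ^ r ≤
        ENNReal.ofReal (A * ε) ^ r *
          ∑ k ∈ Finset.range T, dyadicEnergy r (fun t => W (k + t) ω - W k ω) := by
  obtain ⟨C, hC0, hC⟩ := exists_skorokhodDist_le hq hx hfix
  have hD := chainConst_pos hr
  -- Taking `C + 1` makes the constant strictly positive, as needed when the energy is infinite and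
  -- the right side must be `∞`.
  refine ⟨(C + 1) * (2 * Real.exp q.αon * chainConst r), by positivity, fun ε hε T => ?_⟩
  have hmono : Monotone fun u : ℝ≥0 => Real.exp (q.αon * u) := fun s t hst =>
    Real.exp_le_exp.2 (mul_le_mul_of_nonneg_left (by exact_mod_cast hst) hq.αon_pos.le)
  filter_upwards [hI.ae_abs_sub_le hW.aemeasurable hmono fun _ => (Real.exp_pos _).le, hI.cont,
    hW.cont] with ω hω hIc hWc
  set G := ∑ k ∈ Finset.range T, dyadicEnergy r (fun t => W (k + t) ω - W k ω)
  rcases eq_or_ne G ∞ with hG | hG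
  · rw [hG, ENNReal.mul_top]
    · exact le_top
    · exact pow_ne_zero _ (ENNReal.ofReal_pos.2 (by positivity)).ne'
  set E : ℝ := G.toReal ^ ((r : ℝ)⁻¹)
  have hE0 : 0 ≤ E := by positivity
  have hEr : ENNReal.ofReal E ^ r = G := by
    rw [← ENNReal.ofReal_pow hE0, Real.rpow_inv_natCast_pow ENNReal.toReal_nonneg hr,
      ENNReal.ofReal_toReal hG]
  have hb : NoiseBound q ε (fun t => I t ω) T (2 * Real.exp q.αon * chainConst r * ε * E) := by
    intro k hk t hkt htk
    have hM : ∀ s : ℝ≥0, k ≤ s → s ≤ t → |W s ω - W k ω| ≤ E * chainConst r := fun s hks hst => by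
      have h1 : dyadicEnergy r (fun t => W (k + t) ω - W k ω) ≤ ENNReal.ofReal (E ^ r) := by
        rw [ENNReal.ofReal_pow hE0, hEr]
        exact Finset.single_le_sum
          (f := fun k : ℕ => dyadicEnergy r (fun t => W (k + t) ω - W k ω))
          (fun _ _ => zero_le) (Finset.mem_range.2 hk)
      have h2 := abs_sub_le_dyadicEnergy hr
        ((hWc.comp (continuous_const_add (k : ℝ≥0))).sub continuous_const) hE0 h1 (t := s - k)
        (tsub_le_iff_left.2 (hst.trans htk))
      simpa [add_tsub_cancel_of_le hks] using h2
    have h3 := hω k t hkt _ hM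
    have htk' : (t : ℝ) ≤ k + 1 := by exact_mod_cast htk
    have h4 : Real.exp (q.αon * t) ≤ Real.exp q.αon * Real.exp (q.αon * k) := by
      rw [← Real.exp_add]
      exact Real.exp_le_exp.2 (by nlinarith [hq.αon_pos])
    rw [abs_mul, abs_of_pos hε]
    calc ε * |I t ω - I k ω| ≤ ε * (2 * Real.exp (q.αon * t) * (E * chainConst r)) := by gcongr
      _ ≤ ε * (2 * (Real.exp q.αon * Real.exp (q.αon * k)) * (E * chainConst r)) := by gcongr
      _ = _ := by ring
  have h := hC ε (fun t => I t ω) hIc T _ (by positivity) hb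
  rw [← hEr, ← mul_pow, ← ENNReal.ofReal_mul (by positivity)]
  refine pow_le_pow_left' (h.trans (ENNReal.ofReal_le_ofReal ?_)) r
  have h5 : 0 ≤ 2 * Real.exp q.αon * chainConst r * ε * E := by positivity
  linarith

/-- Each restarted process `W (k + t) - W k` is again a Brownian motion, so all periods have the
same energy bound and the horizon enters only as the factor `T`. -/
theorem exists_lintegral_skorokhodDist_pow_le (hq : q.Admissible)
    (hW : IsBrownianReal W P)
    (hI : IsWienerIntegral P (fun u : ℝ≥0 => Real.exp (q.αon * u)) W I) (hx : x ∈ Icc 0 q.xref)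
    (hfix : q.strobe x = x) {m : ℕ} (hm : 3 ≤ m) : ∃ K : ℝ, 0 ≤ K ∧ ∀ ε : ℝ, 0 < ε → ∀ T : ℕ,
      ∫⁻ ω, skorokhodDist T (noisyState q ε I x ω) (detState q x) ^ (2 * m) ∂P ≤
        ENNReal.ofReal (K * (T * ε ^ (2 * m))) := by
  have hr : 2 * m ≠ 0 := by omega
  obtain ⟨A, hA, h⟩ := exists_ae_skorokhodDist_pow_le hq hW hI hx hfix hr
  set c := 2 * ∫⁻ y, ‖y‖ₑ ^ (2 * m) ∂(gaussianReal 0 1) with hc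
  have hctop : c ≠ ∞ :=
    ENNReal.mul_ne_top (by simp) (lintegral_enorm_pow_gaussianReal_lt_top _ hr).ne
  refine ⟨A ^ (2 * m) * c.toReal, by positivity, fun ε hε T => ?_⟩
  have hshift : ∀ k : ℕ, IsPreBrownianReal (fun t ω => W (k + t) ω - W k ω) P := fun k =>
    hW.toIsPreBrownianReal.shift k
  calc ∫⁻ ω, skorokhodDist T (noisyState q ε I x ω) (detState q x) ^ (2 * m) ∂P
      ≤ ∫⁻ ω, ENNReal.ofReal (A * ε) ^ (2 * m) *
          ∑ k ∈ Finset.range T, dyadicEnergy (2 * m) (fun t => W (k + t) ω - W k ω) ∂P :=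
        lintegral_mono_ae (h ε hε T)
    _ = ENNReal.ofReal (A * ε) ^ (2 * m) * ∑ k ∈ Finset.range T,
          ∫⁻ ω, dyadicEnergy (2 * m) (fun t => W (k + t) ω - W k ω) ∂P := by
        rw [lintegral_const_mul' _ _ (by simp), lintegral_finsetSum']
        exact fun k _ => aemeasurable_dyadicEnergy (fun t => (hshift k).aemeasurable t) _
    _ ≤ ENNReal.ofReal (A * ε) ^ (2 * m) * ∑ k ∈ Finset.range T, c := by
        gcongr with k _
        exact lintegral_dyadicEnergy_le (hshift k) hm
    _ = ENNReal.ofReal (A ^ (2 * m) * c.toReal * (T * ε ^ (2 * m))) := by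
        rw [Finset.sum_const, Finset.card_range, nsmul_eq_mul, ← ENNReal.ofReal_toReal hctop,
          ← ENNReal.ofReal_pow (by positivity), ← ENNReal.ofReal_natCast,
          ← ENNReal.ofReal_mul (by positivity), ← ENNReal.ofReal_mul (by positivity),
          ENNReal.toReal_ofReal (by positivity)]
        congr 1
        ring

end

theorem lintegral_rpow_le_of_exponent_le {Ω : Type*} [MeasurableSpace Ω] {P : Measure Ω}
    [IsProbabilityMeasure P] {d : Ω → ℝ≥0∞} (hd : AEMeasurable d P) {p : ℝ} (hp : 0 < p) {r : ℕ}
    (hpr : p ≤ r) : ∫⁻ ω, d ω ^ p ∂P ≤ (∫⁻ ω, d ω ^ r ∂P) ^ (p / r) := by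
  have h := eLpNorm'_le_eLpNorm'_of_exponent_le hp hpr P hd.aestronglyMeasurable
  rw [eLpNorm'_eq_lintegral_enorm, eLpNorm'_eq_lintegral_enorm] at h
  simp only [enorm_eq_self, ENNReal.rpow_natCast] at h
  have h2 := ENNReal.rpow_le_rpow h hp.le
  rw [← ENNReal.rpow_mul, one_div_mul_cancel hp.ne', ENNReal.rpow_one, ← ENNReal.rpow_mul] at h2
  rwa [one_div_mul_eq_div] at h2

end BuckConverter

theorem theorem3p1 {Ω : Type*} [MeasurableSpace Ω] (P : Measure Ω) [IsProbabilityMeasure P]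
    -- a standard Brownian motion, and the process `I_t = ∫₀ᵗ e^{αon u} dW_u`
    (q : BuckConverter.Params) (hq : q.Admissible)
    (W : ℝ≥0 → Ω → ℝ) (hW : IsBrownianReal W P)
    (I : ℝ≥0 → Ω → ℝ)
    (hI : BuckConverter.IsWienerIntegral P (fun u : ℝ≥0 => Real.exp (q.αon * u)) W I)
    -- the fixed point of the stroboscopic map
    (xstar : ℝ) (hx : xstar ∈ Icc 0 q.xref) (hfix : q.strobe xstar = xstar)
    -- the time horizons
    (T₀ : ℕ) (ν : ℝ) (hν₀ : 0 ≤ ν) (hν : ν < 2 / 3)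
    (T : ℝ → ℕ) (hTpos : ∀ ε ∈ Ioo (0 : ℝ) 1, 0 < T ε)
    (hT : ∀ ε ∈ Ioo (0 : ℝ) 1, (T ε : ℝ) ≤ T₀ / ε ^ ν) :
    (∀ ε ∈ Ioo (0 : ℝ) 1, AEMeasurable (fun ω => BuckConverter.skorokhodDist (T ε)
        (BuckConverter.noisyState q ε I xstar ω) (BuckConverter.detState q xstar)) P) ∧
    (∀ p : ℝ, 1 ≤ p →
      (∀ ε ∈ Ioo (0 : ℝ) 1, ∫⁻ ω, BuckConverter.skorokhodDist (T ε)
          (BuckConverter.noisyState q ε I xstar ω) (BuckConverter.detState q xstar) ^ p ∂P < ∞) ∧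
      Tendsto (fun ε : ℝ => ∫⁻ ω, BuckConverter.skorokhodDist (T ε)
          (BuckConverter.noisyState q ε I xstar ω) (BuckConverter.detState q xstar) ^ p ∂P)
        (𝓝[>] 0) (𝓝 0)) ∧
    (∀ θ : ℝ, 0 < θ →
      Tendsto (fun ε : ℝ => P {ω | ENNReal.ofReal θ ≤ BuckConverter.skorokhodDist (T ε)
          (BuckConverter.noisyState q ε I xstar ω) (BuckConverter.detState q xstar)})
        (𝓝[>] 0) (𝓝 0)) := by
  have hmeas : ∀ ε, AEMeasurable (fun ω => BuckConverter.skorokhodDist (T ε)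
      (BuckConverter.noisyState q ε I xstar ω) (BuckConverter.detState q xstar)) P := fun ε =>
    BuckConverter.aemeasurable_skorokhodDist_noisyState hq
      (fun t => (hI.memLp t).1.aemeasurable) hI.cont hx.1 (hq.strobe_fixed hx hfix).1 (T ε) _
  have hIoo : Ioo (0 : ℝ) 1 ∈ 𝓝[>] (0 : ℝ) := Ioo_mem_nhdsGT one_pos
  have hmom : ∀ p : ℝ, 1 ≤ p →
      (∀ ε ∈ Ioo (0 : ℝ) 1, ∫⁻ ω, BuckConverter.skorokhodDist (T ε)
          (BuckConverter.noisyState q ε I xstar ω) (BuckConverter.detState q xstar) ^ p ∂P < ∞) ∧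
      Tendsto (fun ε : ℝ => ∫⁻ ω, BuckConverter.skorokhodDist (T ε)
          (BuckConverter.noisyState q ε I xstar ω) (BuckConverter.detState q xstar) ^ p ∂P)
        (𝓝[>] 0) (𝓝 0) := by
    intro p hp
    have hp0 : 0 < p := by linarith
    -- The value `3` makes the dyadic energy integrable; `⌈p⌉₊` ensures `p ≤ 2 * m` for Lyapunov's
    -- inequality.
    obtain ⟨m, hm⟩ : ∃ m : ℕ, m = max 3 ⌈p⌉₊ := ⟨_, rfl⟩
    have hm3 : 3 ≤ m := hm ▸ le_max_left _ _
    have hpm : p ≤ (2 * m : ℕ) := by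
      have h1 : (⌈p⌉₊ : ℝ) ≤ m := by exact_mod_cast hm ▸ le_max_right _ _
      have h2 := Nat.le_ceil p
      push_cast
      linarith
    obtain ⟨K, hK0, hK⟩ :=
      BuckConverter.exists_lintegral_skorokhodDist_pow_le hq hW hI hx hfix hm3
    have hle : ∀ ε, 0 < ε → ∫⁻ ω, BuckConverter.skorokhodDist (T ε)
        (BuckConverter.noisyState q ε I xstar ω) (BuckConverter.detState q xstar) ^ p ∂P ≤
        ENNReal.ofReal (K * (T ε * ε ^ (2 * m))) ^ (p / (2 * m : ℕ)) := fun ε hε =>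
      (BuckConverter.lintegral_rpow_le_of_exponent_le (hmeas ε) hp0 hpm).trans
        (ENNReal.rpow_le_rpow (hK ε hε (T ε)) (by positivity))
    refine ⟨fun ε hε => (hle ε hε.1).trans_lt
      (ENNReal.rpow_lt_top_of_nonneg (by positivity) (by simp)), ?_⟩
    have hlim : Tendsto (fun ε : ℝ => K * (T ε * ε ^ (2 * m))) (𝓝[>] 0) (𝓝 0) := by
      have hup : Tendsto (fun ε : ℝ => K * (T₀ * ε ^ ((2 * m : ℕ) - ν))) (𝓝[>] 0) (𝓝 0) := by
        have hexp : 0 < ((2 * m : ℕ) : ℝ) - ν := by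
          have : (3 : ℝ) ≤ m := by exact_mod_cast hm3
          push_cast
          linarith
        have h1 := (Real.continuousAt_rpow_const 0 (((2 * m : ℕ) : ℝ) - ν) (Or.inr hexp.le)).tendsto
        rw [Real.zero_rpow hexp.ne'] at h1
        simpa using ((h1.mono_left nhdsWithin_le_nhds).const_mul (T₀ : ℝ)).const_mul K
      refine tendsto_of_tendsto_of_tendsto_of_le_of_le' tendsto_const_nhds hup ?_ ?_
      · filter_upwards [hIoo] with ε hε
        have := hε.1
        positivity
      · filter_upwards [hIoo] with ε hε
        have hε0 := hε.1
        have h1 : ε ^ (((2 * m : ℕ) : ℝ) - ν) = ε ^ (2 * m) / ε ^ ν := by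
          rw [Real.rpow_sub hε0, Real.rpow_natCast]
        rw [h1]
        refine mul_le_mul_of_nonneg_left ?_ hK0
        calc (T ε : ℝ) * ε ^ (2 * m) ≤ T₀ / ε ^ ν * ε ^ (2 * m) := by
              gcongr
              exact hT ε hε
          _ = T₀ * (ε ^ (2 * m) / ε ^ ν) := by ring
    have hpos : 0 < p / (2 * m : ℕ) := by
      have : 0 < m := by omega
      positivity
    have hlim' : Tendsto (fun ε : ℝ => ENNReal.ofReal (K * (T ε * ε ^ (2 * m))) ^
        (p / (2 * m : ℕ))) (𝓝[>] 0) (𝓝 0) := by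
      have h1 := (ENNReal.continuous_rpow_const (y := p / (2 * m : ℕ))).tendsto 0
      rw [ENNReal.zero_rpow_of_pos hpos] at h1
      have h2 := ENNReal.tendsto_ofReal hlim
      rw [ENNReal.ofReal_zero] at h2
      exact h1.comp h2
    refine tendsto_of_tendsto_of_tendsto_of_le_of_le' tendsto_const_nhds hlim'
      (Eventually.of_forall fun _ => zero_le) ?_
    filter_upwards [hIoo] with ε hε
    exact hle ε hε.1
  refine ⟨fun ε _ => hmeas ε, hmom, fun θ hθ => ?_⟩
  -- Convergence in probability follows from the first moment by Markov's inequality.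
  have h1 := (hmom 1 le_rfl).2
  simp only [ENNReal.rpow_one] at h1
  have h2 := ENNReal.Tendsto.div_const h1 (b := ENNReal.ofReal θ)
    (Or.inr (ENNReal.ofReal_pos.2 hθ).ne')
  rw [ENNReal.zero_div] at h2
  exact tendsto_of_tendsto_of_tendsto_of_le_of_le tendsto_const_nhds h2 (fun _ => zero_le)
    fun ε => meas_ge_le_lintegral_div (hmeas ε) (ENNReal.ofReal_pos.2 hθ).ne' (by simp)
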